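/- Let $G\subset\mathbb R^d$ be a bounded domain with $\partial G\in C^{4,\epsilon}$ for some $\epsilon\in(0,1)$, let $\nu$ be the inward unit normal on $\partial G$, and let $T>0$. Write $C^{\frac{p+\epsilon}{2},p+\epsilon}$ for the parabolic Hölder spaces. Let $b:[0,T]\times\bar G\to\mathbb R^d$, $\sigma:[0,T]\times\bar G\to\mathbb R^{d\times d}$ and $c,g:[0,T]\times\bar G\to\mathbb R$ be of class $C^{1+\epsilon/2,2+\epsilon}([0,T]\times\bar G)$; let $\gamma,\psi\in C^{1+\epsilon/2,2+\epsilon}([0,T]\times\partial G)$, $\mu\in C^{2+\epsilon}(\partial G)$ with $\mu>0$ on $\partial G$, and $\varphi\in C^{4+\epsilon}(\bar G)$, where $\varphi$ is also extended to a locally Lipschitz function on $\mathbb R^d$. (Hölder functions on $\partial G$ are restrictions of Hölder functions on $\bar G$.) Put $a=\sigma\sigma^\top$ and $\mathcal A u=\frac12\sum_{i,j}a^{ij}\partial_{x^i}\partial_{x^j}u+\sum_i b^i\partial_{x^i}u$. Suppose that $u\in C^{2+\epsilon/2,4+\epsilon}([0,T]\times\bar G)$ solves the sticky boundary value problem $$\partial_t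 u+\mathcal A u+cu+g=0\ \text{ on }[0,T]\times\bar G,\qquad u(T,\cdot)=\varphi\ \text{ on }\bar G,$$ $$-\mu\,\mathcal A u+\partial_\nu u+\gamma u=\psi\ \text{ on }[0,T]\times\partial G .$$ Let $t_0\in[0,T)$ and $X_0=x\in G$. For $h\in(0,1)$ the projected Euler scheme is the following Markov chain $(t_k,X_k,Y_k,Z_k)$, started at $(t_0,x,1,0)$. Let $\xi_k^i$ ($k\ge1$, $1\le i\le d$) be independent random variables with values $\pm1$, each with probability $1/2$. As long as $t_k\le T$: * if $X_k\in\bar G$, then $t_{k+1}=t_k+h$, $X_{k+1}=X_k+h\,b(t_k,X_k)+h^{1/2}\sigma(t_k,X_k)\xi_{k+1}$, $Y_{k+1}=Y_k+h\,c(t_k,X_k)Y_k$, $Z_{k+1}=Z_k+h\,g(t_k,X_k)Y_k$; * if $X_k\notin\bar G$, then with $r_k=\mathrm{dist}(X_k,\partial G)$ and $X_{k+1}$ the projection of $X_k$ on $\partial G$ (a point of $\partial G$ at distance $r_k$ from $X_k$; it is unique if $h$ is small), $t_{k+1}=t_k+r_k\mu(X_{k+1})$, $Y_{k+1}=Y_k+r_k\gamma(t_k,X_{k+1})Y_k+r_k\mu(X_{k+1})c(t_k,X_{k+1})Y_k$,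 $Z_{k+1}=Z_k-r_k\psi(t_k,X_{k+1})Y_k+r_k\mu(X_{k+1})g(t_k,X_{k+1})Y_k$. The scheme stops at the first index $\chi$ with $t_\chi>T$. Then the scheme always terminates, $\varphi(X_\chi)Y_\chi+Z_\chi$ is integrable, and there is a constant $C>0$ independent of $h$ such that for all $h\in(0,1)$ $$\big|\mathbb E\big(\varphi(X_\chi)Y_\chi+Z_\chi\big)-u(t_0,X_0)\big|\le C\,h^{1/2}.$$ -/

import Mathlib

open MeasureTheory ProbabilityTheory Set
open scoped NNReal

noncomputable section

namespace StickyEuler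

/-- `d`-dimensional Euclidean space. -/
abbrev Space (d : ℕ) : Type := EuclideanSpace ℝ (Fin d)

/-! ### Hölder spaces -/

/-- The Hölder space `C^{p+ε}(closure G)`: the derivatives up to order `p` exist and are continuous
up to the boundary, and the `p`-th derivative is `ε`-Hölder. (Bounds on the derivatives are
automatic on bounded `G`.) -/
structure MemHolder {d : ℕ} (G : Set (Space d)) (p : ℕ) (ε : ℝ≥0) (f : Space d → ℝ) : Prop where
  contDiffOn : ContDiffOn ℝ p f (closure G)
  holder : ∃ C : ℝ≥0, HolderOnWith C ε (iteratedFDerivWithin ℝ p f (closure G)) (closure G)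

/-- The Hölder space `C^{p+ε}(∂G)`: restrictions to `∂G` of functions in `C^{p+ε}(closure G)`. -/
def MemHolderBoundary {d : ℕ} (G : Set (Space d)) (p : ℕ) (ε : ℝ≥0) (f : Space d → ℝ) : Prop :=
  ∃ F : Space d → ℝ, MemHolder G p ε F ∧ EqOn F f (frontier G)

/-- The mixed derivative `∂_t^i D_x^j u (t, x)` on `[0,T] × closure G` (one-sided at the boundary),
a `j`-linear form on `ℝ^d`. -/
def mixedDeriv {d : ℕ} (T : ℝ) (G : Set (Space d)) (i j : ℕ) (u : ℝ → Space d → ℝ)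
    (t : ℝ) (x : Space d) : ContinuousMultilinearMap ℝ (fun _ : Fin j => Space d) ℝ :=
  iteratedFDerivWithin ℝ j
    (fun y => iteratedDerivWithin i (fun s => u s y) (Icc 0 T) t) (closure G) x

/-- The parabolic Hölder space `C^{(p+ε)/2, p+ε}` on `[0,T] × closure G`: the derivatives
`∂_t^i D_x^j u` with `2i + j ≤ p` exist and are continuous on `[0,T] × closure G`, those with
`2i + j = p` are `ε`-Hölder in `x`, and those with `p + ε - 2i - j < 2` are
`(p + ε - 2i - j)/2`-Hölder in `t`. -/
structure MemParabolicHolder {d : ℕ} (T : ℝ) (G : Set (Space d)) (p : ℕ) (ε : ℝ≥0)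
    (u : ℝ → Space d → ℝ) : Prop where
  contDiffOn_time : ∀ x ∈ closure G, ContDiffOn ℝ (p / 2 : ℕ) (fun s => u s x) (Icc 0 T)
  contDiffOn_space : ∀ i : ℕ, 2 * i ≤ p → ∀ t ∈ Icc 0 T,
    ContDiffOn ℝ (p - 2 * i : ℕ)
      (fun y => iteratedDerivWithin i (fun s => u s y) (Icc 0 T) t) (closure G)
  continuousOn : ∀ i j : ℕ, 2 * i + j ≤ p →
    ContinuousOn (fun q : ℝ × Space d => mixedDeriv T G i j u q.1 q.2) (Icc 0 T ×ˢ closure G)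
  holder_space : ∀ i j : ℕ, 2 * i + j = p →
    ∃ C : ℝ≥0, ∀ t ∈ Icc 0 T, HolderOnWith C ε (fun x => mixedDeriv T G i j u t x) (closure G)
  holder_time : ∀ i j : ℕ, 2 * i + j ≤ p → p ≤ 2 * i + j + 1 →
    ∃ C : ℝ≥0, ∀ x ∈ closure G,
      HolderOnWith C ((((p - (2 * i + j) : ℕ) : ℝ≥0) + ε) / 2)
        (fun t => mixedDeriv T G i j u t x) (Icc 0 T)

/-- The parabolic Hölder space `C^{(p+ε)/2, p+ε}` on `[0,T] × ∂G`: restrictions of functions in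
the corresponding space on `[0,T] × closure G`. -/
def MemParabolicHolderBoundary {d : ℕ} (T : ℝ) (G : Set (Space d)) (p : ℕ) (ε : ℝ≥0)
    (v : ℝ → Space d → ℝ) : Prop :=
  ∃ V : ℝ → Space d → ℝ, MemParabolicHolder T G p ε V ∧
    ∀ t ∈ Icc 0 T, ∀ z ∈ frontier G, V t z = v t z

/-! ### Boundary regularity and the inward normal -/

/-- `ρ` is a `C^1` local defining function of `G` on the open set `U`:
`G ∩ U = {y ∈ U | 0 < ρ y}` and the gradient of `ρ` does not vanish on `U`. -/
structure IsLocalDefiningFunction {d : ℕ} (G U : Set (Space d)) (ρ : Space d → ℝ) : Prop where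
  isOpen : IsOpen U
  contDiffOn : ContDiffOn ℝ 1 ρ U
  gradient_ne_zero : ∀ y ∈ U, gradient ρ y ≠ 0
  mem_iff : ∀ y ∈ U, (y ∈ G ↔ 0 < ρ y)

/-- `∂G` is of class `C^{k,ε}`: near each boundary point, `G` is the positivity set of a
`C^{k,ε}` function with non-vanishing gradient. -/
def HasHolderBoundary {d : ℕ} (k : ℕ) (ε : ℝ≥0) (G : Set (Space d)) : Prop :=
  ∀ z ∈ frontier G, ∃ U : Set (Space d), ∃ ρ : Space d → ℝ,
    z ∈ U ∧ IsLocalDefiningFunction G U ρ ∧ ContDiffOn ℝ k ρ U ∧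
      ∃ C : ℝ≥0, HolderOnWith C ε (iteratedFDeriv ℝ k ρ) U

/-- `v` is the inward unit normal to `∂G` at `z`. -/
def IsInwardUnitNormal {d : ℕ} (G : Set (Space d)) (z v : Space d) : Prop :=
  ∃ U : Set (Space d), ∃ ρ : Space d → ℝ,
    z ∈ U ∧ IsLocalDefiningFunction G U ρ ∧ v = ‖gradient ρ z‖⁻¹ • gradient ρ z

/-! ### The sticky boundary value problem -/

/-- The data of the sticky boundary value problem (with reflection coefficient `ϱ ≡ 1`). -/
structure Problem (d : ℕ) where
  /-- terminal time -/
  T : ℝ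
  /-- spatial domain -/
  G : Set (Space d)
  /-- drift -/
  b : ℝ → Space d → Space d
  /-- diffusion matrix -/
  σ : ℝ → Space d → Matrix (Fin d) (Fin d) ℝ
  /-- zeroth order coefficient -/
  c : ℝ → Space d → ℝ
  /-- source term -/
  g : ℝ → Space d → ℝ
  /-- coefficient of stickiness -/
  μ : Space d → ℝ
  /-- absorption coefficient on the boundary -/
  γ : ℝ → Space d → ℝ
  /-- boundary data -/
  ψ : ℝ → Space d → ℝ
  /-- terminal data; outside `closure G` this is an extension of it -/
  φ : Space d → ℝ

variable {d : ℕ}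

/-- The assumptions on the domain and on the coefficients. The numerical scheme may end at a point
slightly outside `closure G`, where `φ` is evaluated as well, so `φ` is a locally Lipschitz
function on the whole space whose restriction to `closure G` is the terminal datum. -/
structure Problem.IsAdmissible (P : Problem d) (ε : ℝ≥0) : Prop where
  T_pos : 0 < P.T
  isOpen : IsOpen P.G
  isConnected : IsConnected P.G
  isBounded : Bornology.IsBounded P.G
  boundary : HasHolderBoundary 4 ε P.G
  b_mem : ∀ i, MemParabolicHolder P.T P.G 2 ε (fun t x => P.b t x i)
  σ_mem : ∀ i j, MemParabolicHolder P.T P.G 2 ε (fun t x => P.σ t x i j)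
  c_mem : MemParabolicHolder P.T P.G 2 ε P.c
  g_mem : MemParabolicHolder P.T P.G 2 ε P.g
  μ_mem : MemHolderBoundary P.G 2 ε P.μ
  μ_pos : ∀ z ∈ frontier P.G, 0 < P.μ z
  γ_mem : MemParabolicHolderBoundary P.T P.G 2 ε P.γ
  ψ_mem : MemParabolicHolderBoundary P.T P.G 2 ε P.ψ
  φ_mem : MemHolder P.G 4 ε P.φ
  φ_lipschitz : LocallyLipschitz P.φ

/-- The operator `𝒜 u = ½ ∑ a^{ij} ∂²u/∂x^i∂x^j + ∑ b^i ∂u/∂x^i`, with `a = σ σᵀ`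
(derivatives one-sided at `∂G`). -/
def Problem.generator (P : Problem d) (u : ℝ → Space d → ℝ) (t : ℝ) (x : Space d) : ℝ :=
  (1 / 2) * ∑ i, ∑ j, (P.σ t x * (P.σ t x).transpose) i j *
      iteratedFDerivWithin ℝ 2 (u t) (closure P.G) x
        ![EuclideanSpace.single i 1, EuclideanSpace.single j 1]
    + ∑ i, P.b t x i * fderivWithin ℝ (u t) (closure P.G) x (EuclideanSpace.single i 1)

/-- `u` is a classical solution of the parabolic problem with sticky boundary condition, in the
class `C^{(4+ε)/2, 4+ε}` on `[0,T] × closure G`; `ν` is the field of inward unit normals. -/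
structure Problem.IsSolution (P : Problem d) (ε : ℝ≥0) (ν : Space d → Space d)
    (u : ℝ → Space d → ℝ) : Prop where
  regular : MemParabolicHolder P.T P.G 4 ε u
  pde : ∀ t ∈ Icc 0 P.T, ∀ x ∈ closure P.G,
    derivWithin (fun s => u s x) (Icc 0 P.T) t + P.generator u t x
      + P.c t x * u t x + P.g t x = 0
  terminal : ∀ x ∈ closure P.G, u P.T x = P.φ x
  boundary : ∀ t ∈ Icc 0 P.T, ∀ z ∈ frontier P.G,
    -(P.μ z * P.generator u t z) + fderivWithin ℝ (u t) (closure P.G) z (ν z)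
      + P.γ t z * u t z = P.ψ t z

/-! ### The projected Euler scheme -/

/-- `π` assigns to each point outside `closure G` a nearest point of `∂G` (it is unique near
`∂G`). -/
def IsBoundaryProjection (G : Set (Space d)) (π : Space d → Space d) : Prop :=
  ∀ x ∉ closure G, π x ∈ frontier G ∧ dist x (π x) = Metric.infDist x (frontier G)

/-- A state `(t_k, X_k, Y_k, Z_k)` of the chain. -/
structure ChainState (d : ℕ) where
  /-- time -/
  t : ℝ
  /-- position -/
  X : Space d
  /-- multiplicative weight -/
  Y : ℝ
  /-- additive functional -/
  Z : ℝ

/-- The Euler step, used when the position is in `closure G`. -/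
def Problem.eulerStep (P : Problem d) (h : ℝ) (ξ : Fin d → ℝ) (s : ChainState d) :
    ChainState d where
  t := s.t + h
  X := s.X + h • P.b s.t s.X + √h • WithLp.toLp 2 ((P.σ s.t s.X).mulVec ξ)
  Y := s.Y + h * P.c s.t s.X * s.Y
  Z := s.Z + h * P.g s.t s.X * s.Y

/-- The projection step, used when the position is outside `closure G`; here
`r = dist (X, ∂G)` and the new position is the projection of `X` on `∂G`. -/
def Problem.projectionStep (P : Problem d) (π : Space d → Space d) (s : ChainState d) :
    ChainState d :=
  let r := Metric.infDist s.X (frontier P.G)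
  let X' := π s.X
  { t := s.t + r * P.μ X'
    X := X'
    Y := s.Y + r * P.γ s.t X' * s.Y + r * P.μ X' * P.c s.t X' * s.Y
    Z := s.Z - r * P.ψ s.t X' * s.Y + r * P.μ X' * P.g s.t X' * s.Y }

open Classical in
/-- The chain of the projected Euler scheme with step `h`, started at `(t₀, x, 1, 0)` and driven by
`ξ 1, ξ 2, …`. Only its states up to `steps` are used. -/
def Problem.chain (P : Problem d) (π : Space d → Space d) (h t₀ : ℝ) (x : Space d)
    (ξ : ℕ → Fin d → ℝ) : ℕ → ChainState d
  | 0 => ⟨t₀, x, 1, 0⟩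
  | k + 1 =>
    let s := P.chain π h t₀ x ξ k
    if s.X ∈ closure P.G then P.eulerStep h (ξ (k + 1)) s else P.projectionStep π s

/-- The number of steps `χ`: the scheme runs while `t_k ≤ T`. -/
def Problem.steps (P : Problem d) (π : Space d → Space d) (h t₀ : ℝ) (x : Space d)
    (ξ : ℕ → Fin d → ℝ) : ℕ :=
  sInf {k : ℕ | P.T < (P.chain π h t₀ x ξ k).t}

/-- The output `φ(X_χ) Y_χ + Z_χ` of the scheme. -/
def Problem.output (P : Problem d) (π : Space d → Space d) (h t₀ : ℝ) (x : Space d)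
    (ξ : ℕ → Fin d → ℝ) : ℝ :=
  let s := P.chain π h t₀ x ξ (P.steps π h t₀ x ξ)
  P.φ s.X * s.Y + s.Z

/-- The components `ξ_k^i` are independent and take the values `±1` with probability `1/2`. -/
structure IsRademacherSequence {Ω : Type*} [MeasurableSpace Ω] (Pr : Measure Ω)
    (ξ : ℕ → Fin d → Ω → ℝ) : Prop where
  measurable : ∀ k i, Measurable (ξ k i)
  indep : iIndepFun (fun (q : ℕ × Fin d) => ξ q.1 q.2) Pr
  prob_one : ∀ k i, Pr {ω | ξ k i ω = 1} = 1 / 2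
  prob_neg_one : ∀ k i, Pr {ω | ξ k i ω = -1} = 1 / 2

end StickyEuler

end

/-!
Near the boundary the closed domain is quasiconvex, because it contains inward cones of every
aperture smaller than a half-space. Hence the second order Taylor polynomials of `u` at nearby
points agree up to third order errors, and `u` is extended to the exterior by its Taylor polynomial
at the projected point, up to an error of order `3/2` in `h` over the range of an Euler step.

The symmetry of the signs makes the expected error of an Euler step `O(h ^ (3 / 2))` by the
parabolic equation. In a projection step from distance `r` the parabolic equation and the sticky
boundary condition cancel all terms of first order in `r`; since `r` is at most a multiple of `√h`
and the step lasts at least a multiple of `r`, its error is also at most `K * √h` times its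
duration. Summing over the durations, with the exponential growth of the weight `Y`, gives `√h`.

A projection step may be arbitrarily short, but it ends in the closed domain and so is followed by
an Euler step; this forces termination.
-/

noncomputable section

set_option maxSynthPendingDepth 3

namespace StickyEuler

open Filter Metric
open scoped BigOperators RealInnerProductSpace Topology

/-! ### Geometry of the domain -/

section InwardCones

variable {E : Type*} [NormedAddCommGroup E] [InnerProductSpace ℝ E] {G : Set E} {z n : E}

/-- The unit vector `n` is an inward normal to `G` at `z` in the sense of cones: every open cone
with axis `n` and aperture less than a half-space, truncated at a small radius and with apex in
`closure G` near `z`, is contained in `G`. -/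
structure HasInwardCones (G : Set E) (z n : E) : Prop where
  norm_eq_one : ‖n‖ = 1
  exists_ball : ∀ c > 0, ∃ r > 0, ∀ a ∈ ball z r, ∀ b ∈ ball z r ∩ closure G,
    c * ‖a - b‖ < ⟪n, a - b⟫ → a ∈ G

theorem HasInwardCones.uniqueDiffWithinAt (hn : HasInwardCones G z n) (hz : z ∈ closure G) :
    UniqueDiffWithinAt ℝ (closure G) z := by
  obtain ⟨r, hr, hcone⟩ := hn.exists_ball (1 / 2) one_half_pos
  set K : Set E := {v | ‖v‖ < r ∧ 1 / 2 * ‖v‖ < ⟪n, v⟫} with hK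
  have hK_open : IsOpen K :=
    (isOpen_lt (f := fun v => ‖v‖) (by fun_prop) (by fun_prop)).inter
      (isOpen_lt (f := fun v => 1 / 2 * ‖v‖) (by fun_prop) (by fun_prop))
  have hK_nonempty : ((r / 2) • n) ∈ K := by
    simp only [hK, mem_ofPred_eq, norm_smul, hn.norm_eq_one, inner_smul_right,
      real_inner_self_eq_norm_sq, Real.norm_of_nonneg (half_pos hr).le]
    constructor <;> linarith
  have hK_tangent : K ⊆ tangentConeAt ℝ (closure G) z := by
    intro v hv
    suffices hseg : openSegment ℝ z (z + v) ⊆ closure G by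
      simpa using mem_tangentConeAt_of_openSegment_subset hseg
    rw [openSegment_eq_image']
    rintro _ ⟨θ, ⟨hθ0, hθ1⟩, rfl⟩
    rw [add_sub_cancel_left]
    refine subset_closure (hcone _ ?_ z ⟨mem_ball_self hr, hz⟩ ?_)
    · rw [mem_ball, dist_eq_norm, add_sub_cancel_left, norm_smul, Real.norm_of_nonneg hθ0.le]
      exact (mul_le_of_le_one_left (norm_nonneg v) hθ1.le).trans_lt hv.1
    · rw [add_sub_cancel_left, norm_smul, inner_smul_right, Real.norm_of_nonneg hθ0.le,
        mul_left_comm]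
      exact mul_lt_mul_of_pos_left hv.2 hθ0
  refine ⟨?_, by rwa [closure_closure]⟩
  rw [(Submodule.span ℝ (tangentConeAt ℝ (closure G) z)).eq_top_of_nonempty_interior'
    ⟨_, interior_mono (hK_tangent.trans Submodule.subset_span)
      (hK_open.interior_eq.symm ▸ hK_nonempty)⟩]
  exact dense_univ

/-- `x` and `z` are joined within `S` by three segments of length comparable to `‖z - x‖`. -/
def ShortlyJoined {E : Type*} [NormedAddCommGroup E] [NormedSpace ℝ E] (S : Set E) (x z : E) :
    Prop :=
  ∃ p q, segment ℝ x p ⊆ S ∧ segment ℝ p q ⊆ S ∧ segment ℝ q z ⊆ S ∧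
    ‖p - x‖ ≤ 2 * ‖z - x‖ ∧ ‖q - p‖ ≤ ‖z - x‖ ∧ ‖z - q‖ ≤ 2 * ‖z - x‖

theorem shortlyJoined_of_segment_subset {E : Type*} [NormedAddCommGroup E] [NormedSpace ℝ E]
    {S : Set E} {x z : E} (h : segment ℝ x z ⊆ S) : ShortlyJoined S x z :=
  ⟨x, z, by simpa using h (left_mem_segment ℝ x z), h, by simpa using h (right_mem_segment ℝ x z),
    by simp, le_rfl, by simp⟩

theorem HasInwardCones.exists_ball_add_smul_mem (hn : HasInwardCones G z n) :
    ∃ r > 0, ∀ b ∈ ball z r ∩ closure G, ∀ v : E, ∀ s ≤ r, 2 * ‖v‖ ≤ s →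
      b + v + s • n ∈ closure G := by
  obtain ⟨r, hr, hcone⟩ := hn.exists_ball (1 / 4) (by norm_num)
  refine ⟨r / 4, by positivity, fun b hb v s hsr hvs => ?_⟩
  have hs : 0 ≤ s := le_trans (by positivity) hvs
  rcases hs.eq_or_lt with rfl | hs0
  · have hv : v = 0 := norm_le_zero_iff.1 (by linarith)
    simpa [hv] using hb.2
  have hsn : ‖s • n‖ = s := by rw [norm_smul, hn.norm_eq_one, mul_one, Real.norm_of_nonneg hs]
  have hnorm : ‖v + s • n‖ ≤ 3 / 2 * s := (norm_add_le _ _).trans (by linarith)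
  refine subset_closure (hcone _ ?_ b ⟨ball_subset_ball (by linarith) hb.1, hb.2⟩ ?_)
  · have hbz : ‖b - z‖ < r / 4 := by simpa [dist_eq_norm] using hb.1
    rw [mem_ball, dist_eq_norm, show b + v + s • n - z = (b - z) + (v + s • n) by abel]
    linarith [norm_add_le (b - z) (v + s • n)]
  · have hinner : -‖v‖ ≤ ⟪n, v⟫ := by
      simpa [hn.norm_eq_one] using (abs_le.1 (abs_real_inner_le_norm n v)).1
    rw [show b + v + s • n - b = v + s • n by abel, inner_add_right, inner_smul_right,
      real_inner_self_eq_norm_sq, hn.norm_eq_one]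
    linarith

theorem HasInwardCones.exists_ball_shortlyJoined (hn : HasInwardCones G z n) :
    ∃ r > 0, ∀ x ∈ ball z r ∩ closure G, ∀ y ∈ ball z r ∩ closure G,
      ShortlyJoined (closure G) x y := by
  obtain ⟨r, hr, hmem⟩ := hn.exists_ball_add_smul_mem
  refine ⟨r / 4, by positivity, fun x hx y hy => ?_⟩
  set D := ‖y - x‖
  have hD : 2 * D ≤ r := by
    have hxz := mem_ball.1 hx.1
    have hyz := mem_ball.1 hy.1
    linarith [dist_triangle_right y x z, dist_eq_norm y x]
  have hsub : ball z (r / 4) ∩ closure G ⊆ ball z r ∩ closure G :=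
    inter_subset_inter_left _ (ball_subset_ball (by linarith))
  have hray : ∀ b ∈ ball z (r / 4) ∩ closure G,
      segment ℝ b (b + (2 * D) • n) ⊆ closure G := by
    intro b hb
    rw [segment_eq_image']
    rintro _ ⟨θ, ⟨hθ0, hθ1⟩, rfl⟩
    have hθD : θ * (2 * D) ≤ r := (mul_le_of_le_one_left (by positivity) hθ1).trans hD
    simpa [smul_smul] using hmem b (hsub hb) 0 (θ * (2 * D)) hθD
      (by rw [norm_zero, mul_zero]; positivity)
  have hshift : ‖(2 * D) • n‖ = 2 * D := by
    rw [norm_smul, hn.norm_eq_one, mul_one, Real.norm_of_nonneg (by positivity)]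
  refine ⟨x + (2 * D) • n, y + (2 * D) • n, hray x hx, ?_, segment_symm ℝ y _ ▸ hray y hy, ?_, ?_,
    ?_⟩
  · rw [segment_eq_image']
    rintro _ ⟨θ, ⟨hθ0, hθ1⟩, rfl⟩
    have hθD : 2 * ‖θ • (y - x)‖ ≤ 2 * D := by
      rw [norm_smul, Real.norm_of_nonneg hθ0]
      exact mul_le_mul_of_nonneg_left (mul_le_of_le_one_left (norm_nonneg _) hθ1) zero_le_two
    convert hmem x (hsub hx) (θ • (y - x)) (2 * D) hD hθD using 1
    module
  · rw [add_sub_cancel_left, hshift]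
  · rw [add_sub_add_right_eq_sub]
  · rw [sub_add_cancel_left, norm_neg, hshift]

/-- Uniform local quasiconvexity, by a Lebesgue number argument. -/
theorem exists_shortlyJoined (hG : IsOpen G) (hGc : IsCompact (closure G))
    (hn : ∀ z ∈ frontier G, ∃ n, HasInwardCones G z n) :
    ∃ δ > 0, ∀ x ∈ closure G, ∀ z ∈ closure G, ‖z - x‖ < δ → ShortlyJoined (closure G) x z := by
  have hloc : ∀ y : closure G, ∃ r > 0, ∀ x ∈ ball (y : E) r ∩ closure G,
      ∀ z ∈ ball (y : E) r ∩ closure G, ShortlyJoined (closure G) x z := by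
    rintro ⟨y, hy⟩
    by_cases hyG : y ∈ G
    · obtain ⟨r, hr, hrG⟩ := isOpen_iff.1 hG y hyG
      exact ⟨r, hr, fun x hx z hz => shortlyJoined_of_segment_subset <|
        ((convex_ball y r).segment_subset hx.1 hz.1).trans (hrG.trans subset_closure)⟩
    · obtain ⟨n, hyn⟩ := hn y ⟨hy, by rwa [hG.interior_eq]⟩
      exact hyn.exists_ball_shortlyJoined
  choose r hr hjoin using hloc
  obtain ⟨δ, hδ, hcover⟩ := lebesgue_number_lemma_of_metric
    (c := fun y : closure G => ball (y : E) (r y)) hGc (fun _ => isOpen_ball)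
    (fun y hy => mem_iUnion.2 ⟨⟨y, hy⟩, mem_ball_self (hr _)⟩)
  refine ⟨δ, hδ, fun x hx z hz hxz => ?_⟩
  obtain ⟨y, hy⟩ := hcover x hx
  exact hjoin y x ⟨hy (mem_ball_self hδ), hx⟩ z
    ⟨hy (by simpa [mem_ball, dist_eq_norm] using hxz), hz⟩

theorem HasInwardCones.eventually_add_smul_mem (hn : HasInwardCones G z n) (hz : z ∈ closure G)
    {v : E} (hv : 0 < ⟪n, v⟫) : ∀ᶠ s : ℝ in 𝓝[>] 0, z + s • v ∈ G := by
  have hv0 : 0 < ‖v‖ := norm_pos_iff.2 (by rintro rfl; simp at hv)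
  obtain ⟨r, hr, hcone⟩ := hn.exists_ball (⟪n, v⟫ / (2 * ‖v‖)) (by positivity)
  have hball : ∀ᶠ s : ℝ in 𝓝[>] 0, z + s • v ∈ ball z r := by
    have hcont : Continuous fun s : ℝ => z + s • v := by fun_prop
    exact nhdsWithin_le_nhds <|
      hcont.continuousAt.eventually_mem (by simpa using ball_mem_nhds z hr)
  filter_upwards [hball, self_mem_nhdsWithin] with s hs (hs0 : 0 < s)
  refine hcone _ hs z ⟨mem_ball_self hr, hz⟩ ?_
  rw [add_sub_cancel_left, norm_smul, inner_smul_right, Real.norm_of_nonneg hs0.le]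
  have : 0 < s * ⟪n, v⟫ := by positivity
  field_simp
  linarith

end InwardCones

section Projection

variable {E : Type*} [NormedAddCommGroup E] [InnerProductSpace ℝ E]

theorem infDist_frontier_le_dist {E : Type*} [NormedAddCommGroup E] [NormedSpace ℝ E] {G : Set E}
    {x y : E} (hx : x ∈ closure G) (hy : y ∉ closure G) :
    infDist y (frontier G) ≤ dist y x := by
  obtain ⟨w, hw, hwf⟩ : ∃ w ∈ segment ℝ x y, w ∈ frontier G := by
    by_contra! hne
    have hsub : segment ℝ x y ⊆ interior G ∪ (closure G)ᶜ := fun w hw => by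
      by_cases hwc : w ∈ closure G
      · exact Or.inl (by_contra fun hwi => hne w hw ⟨hwc, hwi⟩)
      · exact Or.inr hwc
    obtain ⟨w, -, hw_int, hw_compl⟩ := (convex_segment (𝕜 := ℝ) x y).isPreconnected _ _
      isOpen_interior isClosed_closure.isOpen_compl hsub
      ⟨x, left_mem_segment ℝ x y, (hsub (left_mem_segment ℝ x y)).resolve_right (not_not.2 hx)⟩
      ⟨y, right_mem_segment ℝ x y, hy⟩
    exact hw_compl (subset_closure (interior_subset hw_int))
  refine (infDist_le_dist_of_mem hwf).trans ?_
  rw [dist_comm y w, dist_comm y x, ← dist_add_dist_of_mem_segment hw]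
  exact le_add_of_nonneg_left dist_nonneg

theorem inner_nonpos_of_eventually_norm_le {w v : E}
    (h : ∀ᶠ s : ℝ in 𝓝[>] 0, ‖w‖ ≤ ‖w - s • v‖) : ⟪w, v⟫ ≤ 0 := by
  have hquad : ∀ᶠ s : ℝ in 𝓝[>] 0, 2 * ⟪w, v⟫ ≤ s * ‖v‖ ^ 2 := by
    filter_upwards [h, self_mem_nhdsWithin] with s hs (hs0 : 0 < s)
    have hsq : ‖w‖ ^ 2 ≤ ‖w - s • v‖ ^ 2 := by gcongr
    rw [norm_sub_sq_real, inner_smul_right, norm_smul, Real.norm_of_nonneg hs0.le] at hsq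
    refine le_of_mul_le_mul_left ?_ hs0
    linarith
  have hlim : Tendsto (fun s : ℝ => s * ‖v‖ ^ 2) (𝓝[>] 0) (𝓝 0) := by
    have hcont : Continuous fun s : ℝ => s * ‖v‖ ^ 2 := by fun_prop
    simpa using (hcont.tendsto 0).mono_left nhdsWithin_le_nhds
  linarith [ge_of_tendsto hlim hquad]

theorem eq_neg_norm_smul_of_inner_nonpos {w n : E} (hn : ‖n‖ = 1)
    (h : ∀ v, 0 < ⟪n, v⟫ → ⟪w, v⟫ ≤ 0) : w = -‖w‖ • n := by
  have hnorm : ‖w + ‖w‖ • n‖ ^ 2 = 2 * ‖w‖ * (‖w‖ + ⟪w, n⟫) := by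
    rw [norm_add_sq_real, inner_smul_right, norm_smul, hn, norm_norm]
    ring
  suffices hzero : ‖w + ‖w‖ • n‖ ^ 2 = 0 by
    rw [neg_smul]
    exact eq_neg_of_add_eq_zero_left (by simpa using hzero)
  by_contra hne
  have hpos : 0 < 2 * ‖w‖ * (‖w‖ + ⟪w, n⟫) := hnorm ▸ lt_of_le_of_ne (sq_nonneg _) (Ne.symm hne)
  have hw : 0 < ‖w‖ := (norm_nonneg w).lt_of_ne fun h0 => by simp [← h0] at hpos
  have hcos : 0 < ‖w‖ + ⟪w, n⟫ := pos_of_mul_pos_right hpos (by positivity)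
  have hle := h (w + ‖w‖ • n) (by
    rw [inner_add_right, inner_smul_right, real_inner_self_eq_norm_sq, hn, real_inner_comm]
    linarith)
  rw [inner_add_right, inner_smul_right, real_inner_self_eq_norm_sq] at hle
  nlinarith

/-- First-order optimality of the nearest boundary point in all directions pointing into `G`. -/
theorem HasInwardCones.sub_eq_of_dist_eq_infDist {G : Set E} {y z n : E}
    (hn : HasInwardCones G z n) (hz : z ∈ closure G) (hy : y ∉ closure G)
    (hd : dist y z = infDist y (frontier G)) : y - z = -infDist y (frontier G) • n := by
  have hopt : ∀ v, 0 < ⟪n, v⟫ → ⟪y - z, v⟫ ≤ 0 := by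
    intro v hv
    refine inner_nonpos_of_eventually_norm_le ?_
    filter_upwards [hn.eventually_add_smul_mem hz hv] with s hs
    rw [sub_sub, ← dist_eq_norm, ← dist_eq_norm, hd]
    exact infDist_frontier_le_dist (subset_closure hs) hy
  rw [← hd, dist_eq_norm]
  exact eq_neg_norm_smul_of_inner_nonpos hn.norm_eq_one hopt

end Projection

variable {d : ℕ}

theorem IsLocalDefiningFunction.nonneg_of_mem_closure {G U : Set (Space d)} {ρ : Space d → ℝ}
    (hρ : IsLocalDefiningFunction G U ρ) {y : Space d} (hyU : y ∈ U) (hyG : y ∈ closure G) :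
    0 ≤ ρ y := by
  by_contra! hlt
  have hU : U ∈ 𝓝 y := hρ.isOpen.mem_nhds hyU
  have hneg : ∀ᶠ w in 𝓝 y, ρ w < 0 ∧ w ∈ U :=
    ((hρ.contDiffOn.continuousOn.continuousAt hU).eventually (gt_mem_nhds hlt)).and hU
  obtain ⟨w, ⟨hw, hwU⟩, hwG⟩ := mem_closure_iff_nhds.1 hyG _ hneg
  exact hw.not_gt ((hρ.mem_iff w hwU).1 hwG)

/-- By strict differentiability, `ρ a - ρ b` is positive as soon as `a - b` lies in a cone around
the gradient. -/
theorem IsInwardUnitNormal.hasInwardCones {G : Set (Space d)} {z n : Space d}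
    (hn : IsInwardUnitNormal G z n) : HasInwardCones G z n := by
  obtain ⟨U, ρ, hzU, hρ, rfl⟩ := hn
  have hgrad : 0 < ‖gradient ρ z‖ := norm_pos_iff.2 (hρ.gradient_ne_zero z hzU)
  refine ⟨by simp [norm_smul, hgrad.ne'], fun c hc => ?_⟩
  have hstrict : HasStrictFDerivAt ρ (fderiv ℝ ρ z) z :=
    (hρ.contDiffOn.contDiffAt (hρ.isOpen.mem_nhds hzU)).hasStrictFDerivAt one_ne_zero
  have hU : U ∈ 𝓝 z := hρ.isOpen.mem_nhds hzU
  obtain ⟨r, hr, hball⟩ := eventually_nhds_iff_ball.1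
    ((hstrict.isLittleO.bound (mul_pos hc hgrad)).and (prod_mem_nhds hU hU))
  refine ⟨r, hr, fun a ha b hb hab => ?_⟩
  obtain ⟨hlin, haU, hbU⟩ := hball (a, b) (by rw [← ball_prod_same]; exact ⟨ha, hb.1⟩)
  have hcone : c * ‖gradient ρ z‖ * ‖a - b‖ < fderiv ℝ ρ z (a - b) := by
    rw [real_inner_smul_left, show ⟪gradient ρ z, a - b⟫ = fderiv ℝ ρ z (a - b) by
      simp [gradient]] at hab
    field_simp at hab
    linarith
  rw [hρ.mem_iff a haU]
  linarith [(abs_le.1 hlin).1, hρ.nonneg_of_mem_closure hbU hb.2]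

theorem uniqueDiffOn_closure {E : Type*} [NormedAddCommGroup E] [InnerProductSpace ℝ E]
    {G : Set E} (hG : IsOpen G) (hn : ∀ z ∈ frontier G, ∃ n, HasInwardCones G z n) :
    UniqueDiffOn ℝ (closure G) := by
  intro z hz
  by_cases hzG : z ∈ G
  · exact (hG.uniqueDiffWithinAt hzG).mono subset_closure
  · obtain ⟨n, hzn⟩ := hn z ⟨hz, by rwa [hG.interior_eq]⟩
    exact hzn.uniqueDiffWithinAt hz

/-! ### Second order Taylor polynomials on quasiconvex sets -/

section Taylor

variable {E F : Type*} [NormedAddCommGroup E] [NormedSpace ℝ E] [NormedAddCommGroup F]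
  [NormedSpace ℝ F] {S : Set E} {f : E → F} {M : ℝ} {x y z : E}

/-- The second derivative within `S`, as a bilinear map. -/
abbrev sndDeriv (S : Set E) (f : E → F) (x : E) : E →L[ℝ] E →L[ℝ] F :=
  fderivWithin ℝ (fderivWithin ℝ f S) S x

/-- The second order Taylor polynomial at `x` of a function on `S`, evaluated at `y`. -/
def taylorTwo (S : Set E) (f : E → F) (x y : E) : F :=
  f x + fderivWithin ℝ f S x (y - x) + (1 / 2 : ℝ) • sndDeriv S f x (y - x) (y - x)

@[simp]
theorem taylorTwo_self (S : Set E) (f : E → F) (x : E) : taylorTwo S f x x = f x := by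
  simp [taylorTwo]

/-- The first and second order terms telescope, so that only the third derivative survives. -/
theorem hasFDerivWithinAt_taylorTwo (hS : UniqueDiffOn ℝ S) (hSi : S ⊆ closure (interior S))
    (hf : ContDiffOn ℝ 3 f S) (y : E) (hx : x ∈ S) :
    HasFDerivWithinAt (fun x => taylorTwo S f x y)
      ((1 / 2 : ℝ) • ((ContinuousLinearMap.apply ℝ F (y - x)).comp
        ((ContinuousLinearMap.apply ℝ (E →L[ℝ] F) (y - x)).comp
          (fderivWithin ℝ (sndDeriv S f) S x)))) S x := by
  have hf1 : ContDiffOn ℝ 2 (fderivWithin ℝ f S) S := hf.fderivWithin hS (by norm_num)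
  have hf2 : ContDiffOn ℝ 1 (sndDeriv S f) S := hf1.fderivWithin hS (by norm_num)
  have h0 : HasFDerivWithinAt f (fderivWithin ℝ f S x) S x :=
    (hf.differentiableOn (by norm_num) x hx).hasFDerivWithinAt
  have h1 : HasFDerivWithinAt (fderivWithin ℝ f S) (sndDeriv S f x) S x :=
    (hf1.differentiableOn (by norm_num) x hx).hasFDerivWithinAt
  have h2 : HasFDerivWithinAt (sndDeriv S f) (fderivWithin ℝ (sndDeriv S f) S x) S x :=
    (hf2.differentiableOn (by norm_num) x hx).hasFDerivWithinAt
  have hsub : HasFDerivWithinAt (fun x : E => y - x) (-ContinuousLinearMap.id ℝ E) S x :=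
    (hasFDerivWithinAt_id x S).const_sub y
  have hsymm : IsSymmSndFDerivWithinAt ℝ f S x :=
    (hf x hx).isSymmSndFDerivWithinAt (by simp; norm_num) hS (hSi hx) hx
  refine ((h0.add (h1.clm_apply hsub)).add
    (((h2.clm_apply hsub).clm_apply hsub).const_smul (1 / 2 : ℝ))).congr_fderiv ?_
  ext v
  have hcomm := hsymm v (y - x)
  generalize y - x = w at hcomm ⊢
  simp [sndDeriv, hcomm]
  module

theorem norm_taylorTwo_sub_le_of_segment (hS : UniqueDiffOn ℝ S)
    (hSi : S ⊆ closure (interior S)) (hf : ContDiffOn ℝ 3 f S)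
    (hM : ∀ x ∈ S, ‖fderivWithin ℝ (sndDeriv S f) S x‖ ≤ M) {p : E} {R : ℝ}
    (hxp : segment ℝ x p ⊆ S) (hx : ‖y - x‖ ≤ R) (hp : ‖y - p‖ ≤ R) :
    ‖taylorTwo S f p y - taylorTwo S f x y‖ ≤ M * R ^ 2 * ‖p - x‖ := by
  have hM0 : 0 ≤ M := (norm_nonneg _).trans (hM x (hxp (left_mem_segment ℝ x p)))
  have hR0 : 0 ≤ R := (norm_nonneg _).trans hx
  have hR : ∀ w ∈ segment ℝ x p, ‖y - w‖ ≤ R := fun w hw => by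
    rw [← dist_eq_norm] at hx hp ⊢
    exact mem_closedBall'.1 <| (convex_closedBall y R).segment_subset
      (mem_closedBall'.2 hx) (mem_closedBall'.2 hp) hw
  refine (convex_segment (𝕜 := ℝ) x p).norm_image_sub_le_of_norm_hasFDerivWithin_le
    (f := fun x => taylorTwo S f x y)
    (fun w hw => (hasFDerivWithinAt_taylorTwo hS hSi hf y (hxp hw)).mono hxp)
    (fun w hw => ?_) (left_mem_segment ℝ x p) (right_mem_segment ℝ x p)
  refine ContinuousLinearMap.opNorm_le_bound _ (by positivity) fun v => ?_
  simp only [smul_apply, ContinuousLinearMap.comp_apply, ContinuousLinearMap.apply_apply, norm_smul]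
  have h1 := (fderivWithin ℝ (sndDeriv S f) S w).le_of_opNorm_le (hM w (hxp hw)) v
  have h2 := ((fderivWithin ℝ (sndDeriv S f) S w) v).le_of_opNorm_le_of_le h1 (hR w hw)
  have h3 := ((fderivWithin ℝ (sndDeriv S f) S w) v (y - w)).le_of_opNorm_le_of_le h2 (hR w hw)
  calc ‖(1 / 2 : ℝ)‖ * ‖(fderivWithin ℝ (sndDeriv S f) S w) v (y - w) (y - w)‖
      ≤ 1 * (((M * ‖v‖) * R) * R) := by
        refine mul_le_mul (by norm_num) h3 (norm_nonneg _) zero_le_one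
    _ = M * R ^ 2 * ‖v‖ := by ring

theorem ShortlyJoined.norm_taylorTwo_sub_le (hxz : ShortlyJoined S x z) (hS : UniqueDiffOn ℝ S)
    (hSi : S ⊆ closure (interior S)) (hf : ContDiffOn ℝ 3 f S)
    (hM : ∀ x ∈ S, ‖fderivWithin ℝ (sndDeriv S f) S x‖ ≤ M) {R : ℝ}
    (hx : ‖y - x‖ ≤ R) (hz : ‖y - z‖ ≤ R) (hR : ‖z - x‖ ≤ R) :
    ‖taylorTwo S f z y - taylorTwo S f x y‖ ≤ 45 * M * R ^ 3 := by
  obtain ⟨p, q, hxp, hpq, hqz, hp, hq, hz'⟩ := hxz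
  have hM0 : 0 ≤ M := (norm_nonneg _).trans (hM x (hxp (left_mem_segment ℝ x p)))
  have hyp : ‖y - p‖ ≤ 3 * R := by
    linarith [norm_sub_le_norm_sub_add_norm_sub (a := y) (b := x) (c := p), norm_sub_rev x p]
  have hyq : ‖y - q‖ ≤ 3 * R := by
    linarith [norm_sub_le_norm_sub_add_norm_sub (a := y) (b := z) (c := q)]
  have hR0 : 0 ≤ R := (norm_nonneg _).trans hx
  have h1 := norm_taylorTwo_sub_le_of_segment hS hSi hf hM hxp (by linarith) hyp
  have h2 := norm_taylorTwo_sub_le_of_segment hS hSi hf hM hpq hyp hyq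
  have h3 := norm_taylorTwo_sub_le_of_segment hS hSi hf hM hqz hyq (by linarith)
  calc ‖taylorTwo S f z y - taylorTwo S f x y‖
      = ‖(taylorTwo S f z y - taylorTwo S f q y) + (taylorTwo S f q y - taylorTwo S f p y) +
          (taylorTwo S f p y - taylorTwo S f x y)‖ := by congr 1; abel
    _ ≤ M * (3 * R) ^ 2 * (‖z - q‖ + ‖q - p‖ + ‖p - x‖) := by
        refine norm_add₃_le.trans ?_
        linarith
    _ ≤ M * (3 * R) ^ 2 * (5 * R) := by gcongr; linarith
    _ = 45 * M * R ^ 3 := by ring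

/-- The derivatives of `f` within `S` up to order three exist and are bounded by `M`. -/
structure HasDerivBound (S : Set E) (M : ℝ) (f : E → F) : Prop where
  contDiffOn : ContDiffOn ℝ 3 f S
  zero : ∀ x ∈ S, ‖f x‖ ≤ M
  one : ∀ x ∈ S, ‖fderivWithin ℝ f S x‖ ≤ M
  two : ∀ x ∈ S, ‖sndDeriv S f x‖ ≤ M
  three : ∀ x ∈ S, ‖fderivWithin ℝ (sndDeriv S f) S x‖ ≤ M

namespace HasDerivBound

theorem norm_taylorTwo_sub_sub_le (hf : HasDerivBound S M f) (hx : x ∈ S) (y : E) :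
    ‖taylorTwo S f x y - f x - fderivWithin ℝ f S x (y - x)‖ ≤ M * ‖y - x‖ ^ 2 := by
  rw [taylorTwo, sub_sub, add_sub_cancel_left, norm_smul]
  refine (mul_le_of_le_one_left (norm_nonneg _) (by norm_num)).trans ?_
  calc ‖sndDeriv S f x (y - x) (y - x)‖ ≤ M * ‖y - x‖ * ‖y - x‖ :=
        (sndDeriv S f x (y - x)).le_of_opNorm_le
          ((sndDeriv S f x).le_of_opNorm_le (hf.two x hx) _) _
    _ = M * ‖y - x‖ ^ 2 := by ring

theorem norm_taylorTwo_le (hf : HasDerivBound S M f) (hx : x ∈ S) (y : E) :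
    ‖taylorTwo S f x y‖ ≤ M * (1 + ‖y - x‖ + ‖y - x‖ ^ 2) := by
  have h1 : ‖fderivWithin ℝ f S x (y - x)‖ ≤ M * ‖y - x‖ :=
    (fderivWithin ℝ f S x).le_of_opNorm_le (hf.one x hx) _
  rw [← sub_add_cancel (taylorTwo S f x y) (f x + fderivWithin ℝ f S x (y - x)), ← sub_sub]
  refine (norm_add_le _ _).trans ?_
  linarith [hf.zero x hx, hf.norm_taylorTwo_sub_sub_le hx y,
    norm_add_le (f x) (fderivWithin ℝ f S x (y - x))]

theorem norm_taylorTwo_le_mul_pow (hf : HasDerivBound S M f) (hx : x ∈ S) {δ R : ℝ} (hδ : 0 < δ)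
    (hδR : δ ≤ R) (hyx : ‖y - x‖ ≤ R) :
    ‖taylorTwo S f x y‖ ≤ M * (δ⁻¹ ^ 3 + δ⁻¹ ^ 2 + δ⁻¹) * R ^ 3 := by
  have hM : 0 ≤ M := (norm_nonneg _).trans (hf.zero x hx)
  have hR : 0 ≤ R := hδ.le.trans hδR
  have hone : 1 ≤ δ⁻¹ * R := by rwa [inv_mul_eq_div, one_le_div hδ]
  calc ‖taylorTwo S f x y‖ ≤ M * (1 + R + R ^ 2) :=
        (hf.norm_taylorTwo_le hx y).trans (by gcongr)
    _ ≤ M * ((δ⁻¹ * R) ^ 3 + R * (δ⁻¹ * R) ^ 2 + R ^ 2 * (δ⁻¹ * R)) := by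
        gcongr
        · exact one_le_pow₀ hone
        · exact le_mul_of_one_le_right hR (one_le_pow₀ hone)
        · exact le_mul_of_one_le_right (by positivity) hone
    _ = M * (δ⁻¹ ^ 3 + δ⁻¹ ^ 2 + δ⁻¹) * R ^ 3 := by ring

end HasDerivBound

/-- Whitney-type compatibility: the Taylor polynomials of `f` at two points of `S` differ by a third
order term. -/
def TaylorCompatible (S : Set E) (C : ℝ) (f : E → F) : Prop :=
  ∀ x ∈ S, ∀ z ∈ S, ∀ y, ‖taylorTwo S f z y - taylorTwo S f x y‖ ≤ C * (‖z - x‖ + ‖y - x‖) ^ 3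

theorem exists_taylorCompatible (hS : UniqueDiffOn ℝ S) (hSi : S ⊆ closure (interior S))
    {δ : ℝ} (hδ : 0 < δ) (hjoin : ∀ x ∈ S, ∀ z ∈ S, ‖z - x‖ < δ → ShortlyJoined S x z)
    (hM : 0 ≤ M) :
    ∃ C, 0 ≤ C ∧ ∀ f : E → F, HasDerivBound S M f → TaylorCompatible S C f := by
  refine ⟨45 * M + 2 * (M * (δ⁻¹ ^ 3 + δ⁻¹ ^ 2 + δ⁻¹)), by positivity, fun f hf x hx z hz y => ?_⟩
  set R := ‖z - x‖ + ‖y - x‖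
  have hzx : ‖z - x‖ ≤ R := le_add_of_nonneg_right (norm_nonneg _)
  have hyx : ‖y - x‖ ≤ R := le_add_of_nonneg_left (norm_nonneg _)
  have hyz : ‖y - z‖ ≤ R := by
    linarith [norm_sub_le_norm_sub_add_norm_sub (a := y) (b := x) (c := z), norm_sub_rev x z]
  have : 0 ≤ R := (norm_nonneg _).trans hzx
  rw [add_mul]
  rcases lt_or_ge ‖z - x‖ δ with hnear | hfar
  · exact ((hjoin x hx z hz hnear).norm_taylorTwo_sub_le hS hSi hf.contDiffOn hf.three hyx hyz
      hzx).trans (le_add_of_nonneg_right (by positivity))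
  · refine (norm_sub_le _ _).trans (le_add_of_nonneg_of_le (by positivity) ?_)
    linarith [hf.norm_taylorTwo_le_mul_pow hz hδ (hfar.trans hzx) hyz,
      hf.norm_taylorTwo_le_mul_pow hx hδ (hfar.trans hzx) hyx]

open Classical in
/-- Extension of a function on `S` to the whole space by its second order Taylor polynomials; `π`
selects the base point in `S` for each point outside `S`. -/
def taylorExtension (S : Set E) (π : E → E) (f : E → F) (y : E) : F :=
  if y ∈ S then f y else taylorTwo S f (π y) y

theorem taylorExtension_of_mem (hy : y ∈ S) (π : E → E) (f : E → F) :
    taylorExtension S π f y = f y :=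
  if_pos hy

theorem taylorExtension_of_notMem (hy : y ∉ S) (π : E → E) (f : E → F) :
    taylorExtension S π f y = taylorTwo S f (π y) y :=
  if_neg hy

theorem TaylorCompatible.norm_taylorExtension_sub_taylorTwo_le {C : ℝ}
    (hf : TaylorCompatible S C f) (hC : 0 ≤ C) (hx : x ∈ S) {π : E → E}
    (hπ : y ∉ S → π y ∈ S ∧ ‖y - π y‖ ≤ ‖y - x‖) :
    ‖taylorExtension S π f y - taylorTwo S f x y‖ ≤ 27 * C * ‖y - x‖ ^ 3 := by
  obtain ⟨z, hz, hyz, hext⟩ : ∃ z ∈ S, ‖y - z‖ ≤ ‖y - x‖ ∧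
      taylorExtension S π f y = taylorTwo S f z y := by
    by_cases hy : y ∈ S
    · exact ⟨y, hy, by simp, by rw [taylorExtension_of_mem hy, taylorTwo_self]⟩
    · exact ⟨π y, (hπ hy).1, (hπ hy).2, taylorExtension_of_notMem hy π f⟩
  have hzx : ‖z - x‖ ≤ 2 * ‖y - x‖ := by
    linarith [norm_sub_le_norm_sub_add_norm_sub (a := z) (b := y) (c := x), norm_sub_rev y z]
  calc ‖taylorExtension S π f y - taylorTwo S f x y‖ ≤ C * (‖z - x‖ + ‖y - x‖) ^ 3 :=
        hext ▸ hf x hx z hz y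
    _ ≤ C * (2 * ‖y - x‖ + ‖y - x‖) ^ 3 := by gcongr
    _ = 27 * C * ‖y - x‖ ^ 3 := by ring

end Taylor

/-! ### Bounds on the data -/

theorem norm_sub_sub_smul_derivWithin_le {F : Type*} [NormedAddCommGroup F] [NormedSpace ℝ F]
    {I : Set ℝ} {f : ℝ → F} {M s t : ℝ} (hI : Convex ℝ I) (hu : UniqueDiffOn ℝ I)
    (hf : ContDiffOn ℝ 2 f I) (hM : ∀ r ∈ I, ‖iteratedDerivWithin 2 f I r‖ ≤ M)
    (hs : s ∈ I) (ht : t ∈ I) :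
    ‖f t - f s - (t - s) • derivWithin f I s‖ ≤ M * (t - s) ^ 2 := by
  have hM0 : 0 ≤ M := (norm_nonneg _).trans (hM s hs)
  have hf' : DifferentiableOn ℝ (derivWithin f I) I :=
    (hf.derivWithin hu (m := 1) (by norm_num)).differentiableOn (by norm_num)
  have hlip : ∀ r ∈ I, ‖derivWithin f I r - derivWithin f I s‖ ≤ M * |r - s| := fun r hr =>
    hI.norm_image_sub_le_of_norm_derivWithin_le hf' (fun q hq => by
      have hq' := hM q hq
      rwa [iteratedDerivWithin_succ, iteratedDerivWithin_one] at hq') hs hr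
  have hsub : uIcc s t ⊆ I := hI.ordConnected.uIcc_subset hs ht
  have hbound := (convex_uIcc s t).norm_image_sub_le_of_norm_hasDerivWithin_le
    (f := fun r => f r - (r - s) • derivWithin f I s)
    (f' := fun r => derivWithin f I r - (1 : ℝ) • derivWithin f I s) (C := M * |t - s|)
    (fun r hr => ((hf.differentiableOn (by norm_num) r (hsub hr)).hasDerivWithinAt.mono hsub).sub
      (((hasDerivWithinAt_id r _).sub_const s).smul_const _))
    (fun r hr => by
      rw [one_smul]
      exact (hlip r (hsub hr)).trans
        (mul_le_mul_of_nonneg_left (abs_sub_left_of_mem_uIcc hr) hM0))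
    left_mem_uIcc right_mem_uIcc
  simp only [sub_self, zero_smul, sub_zero] at hbound
  rwa [sub_right_comm, Real.norm_eq_abs, mul_assoc, abs_mul_abs_self, ← sq] at hbound

section DataBounds

variable {T : ℝ} {G : Set (Space d)} {p : ℕ} {ε : ℝ≥0} {f : ℝ → Space d → ℝ}

namespace MemParabolicHolder

theorem exists_norm_mixedDeriv_le (hf : MemParabolicHolder T G p ε f)
    (hG : Bornology.IsBounded G) {i j : ℕ} (hij : 2 * i + j ≤ p) :
    ∃ C, ∀ t ∈ Icc 0 T, ∀ x ∈ closure G, ‖mixedDeriv T G i j f t x‖ ≤ C := by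
  obtain ⟨C, hC⟩ := (isCompact_Icc.prod hG.isCompact_closure).exists_bound_of_continuousOn
    (hf.continuousOn i j hij)
  exact ⟨C, fun t ht x hx => hC (t, x) ⟨ht, hx⟩⟩

theorem eventually_abs_iteratedDerivWithin_le (hf : MemParabolicHolder T G p ε f)
    (hG : Bornology.IsBounded G) {i : ℕ} (hi : 2 * i ≤ p) :
    ∀ᶠ M in atTop, ∀ t ∈ Icc 0 T, ∀ x ∈ closure G,
      |iteratedDerivWithin i (fun s => f s x) (Icc 0 T) t| ≤ M := by
  obtain ⟨C, hC⟩ := hf.exists_norm_mixedDeriv_le hG (i := i) (j := 0) hi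
  filter_upwards [eventually_ge_atTop C] with M hM t ht x hx
  simpa only [mixedDeriv, norm_iteratedFDerivWithin_zero, Real.norm_eq_abs]
    using (hC t ht x hx).trans hM

theorem eventually_norm_iteratedFDerivWithin_le (hf : MemParabolicHolder T G p ε f)
    (hG : Bornology.IsBounded G) {j : ℕ} (hj : j ≤ p) :
    ∀ᶠ M in atTop, ∀ t ∈ Icc 0 T, ∀ x ∈ closure G,
      ‖iteratedFDerivWithin ℝ j (f t) (closure G) x‖ ≤ M := by
  obtain ⟨C, hC⟩ := hf.exists_norm_mixedDeriv_le hG (i := 0) (j := j) (by lia)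
  filter_upwards [eventually_ge_atTop C] with M hM t ht x hx
  simpa only [mixedDeriv, iteratedDerivWithin_zero] using (hC t ht x hx).trans hM

end MemParabolicHolder

/-- `f` is bounded by `M` and `M`-Lipschitz in time on `[0,T] × closure G`. -/
structure HasTimeLipschitzBound {F : Type*} [NormedAddCommGroup F] (T : ℝ) (G : Set (Space d))
    (M : ℝ) (f : ℝ → Space d → F) : Prop where
  norm_le : ∀ t ∈ Icc 0 T, ∀ x ∈ closure G, ‖f t x‖ ≤ M
  norm_sub_le : ∀ s ∈ Icc 0 T, ∀ t ∈ Icc 0 T, ∀ x ∈ closure G, ‖f t x - f s x‖ ≤ M * |t - s|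

theorem sum_smul_single {ι : Type*} [Fintype ι] [DecidableEq ι] (v : EuclideanSpace ℝ ι) :
    ∑ i, v i • EuclideanSpace.single i (1 : ℝ) = v := by
  simpa using (EuclideanSpace.basisFun ι ℝ).sum_repr v

theorem norm_le_sum_abs {ι : Type*} [Fintype ι] (v : EuclideanSpace ℝ ι) : ‖v‖ ≤ ∑ i, |v i| := by
  classical
  rw [← sum_smul_single v]
  refine (norm_sum_le _ _).trans_eq ?_
  simp only [sum_smul_single, norm_smul, Real.norm_eq_abs, PiLp.norm_single, norm_one,
    mul_one]

namespace HasTimeLipschitzBound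

theorem mono {F : Type*} [NormedAddCommGroup F] {M M' : ℝ} {f : ℝ → Space d → F}
    (hf : HasTimeLipschitzBound T G M f) (hM : M ≤ M') : HasTimeLipschitzBound T G M' f where
  norm_le t ht x hx := (hf.norm_le t ht x hx).trans hM
  norm_sub_le s hs t ht x hx := (hf.norm_sub_le s hs t ht x hx).trans (by gcongr)

theorem of_coord {ι : Type*} [Fintype ι] {M : ℝ} {f : ℝ → Space d → EuclideanSpace ℝ ι}
    (hf : ∀ i, HasTimeLipschitzBound T G M (fun t x => f t x i)) :
    HasTimeLipschitzBound T G (Fintype.card ι * M) f where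
  norm_le t ht x hx := (norm_le_sum_abs _).trans <|
    (Finset.sum_le_card_nsmul _ _ M fun i _ => (hf i).norm_le t ht x hx).trans_eq (by simp)
  norm_sub_le s hs t ht x hx := (norm_le_sum_abs _).trans <|
    (Finset.sum_le_card_nsmul _ _ (M * |t - s|) fun i _ =>
      (hf i).norm_sub_le s hs t ht x hx).trans_eq (by simp [mul_assoc])

end HasTimeLipschitzBound

namespace MemParabolicHolder

theorem eventually_hasTimeLipschitzBound (hf : MemParabolicHolder T G p ε f)
    (hG : Bornology.IsBounded G) (hp : 2 ≤ p) :
    ∀ᶠ M in atTop, HasTimeLipschitzBound T G M f := by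
  filter_upwards [hf.eventually_abs_iteratedDerivWithin_le hG (i := 0) (by lia),
    hf.eventually_abs_iteratedDerivWithin_le hG (i := 1) (by lia)] with M h0 h1
  refine ⟨by simpa only [iteratedDerivWithin_zero, Real.norm_eq_abs] using h0,
    fun s hs t ht x hx => ?_⟩
  have hp' : ((p / 2 : ℕ) : WithTop ℕ∞) ≠ 0 := by
    have : p / 2 ≠ 0 := by lia
    exact_mod_cast this
  refine (convex_Icc 0 T).norm_image_sub_le_of_norm_derivWithin_le (f := fun s => f s x)
    ((hf.contDiffOn_time x hx).differentiableOn hp') (fun r hr => ?_) hs ht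
  simpa only [iteratedDerivWithin_one, Real.norm_eq_abs] using h1 r hr x hx

theorem eventually_hasTimeLipschitzBound_of_coord {ι : Type*} [Fintype ι]
    {f : ℝ → Space d → EuclideanSpace ℝ ι} (hf : ∀ i, MemParabolicHolder T G p ε fun t x => f t x i)
    (hG : Bornology.IsBounded G) (hp : 2 ≤ p) :
    ∀ᶠ M in atTop, HasTimeLipschitzBound T G M f := by
  obtain ⟨M₀, hM₀⟩ :=
    (eventually_all.2 fun i => (hf i).eventually_hasTimeLipschitzBound hG hp).exists
  filter_upwards [eventually_ge_atTop _] with M hM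
  exact (HasTimeLipschitzBound.of_coord hM₀).mono hM

theorem eventually_hasDerivBound (hf : MemParabolicHolder T G p ε f) (hG : Bornology.IsBounded G)
    (hS : UniqueDiffOn ℝ (closure G)) (hp : 3 ≤ p) :
    ∀ᶠ M in atTop, ∀ t ∈ Icc 0 T, HasDerivBound (closure G) M (f t) := by
  filter_upwards [hf.eventually_norm_iteratedFDerivWithin_le hG (j := 0) (by lia),
    hf.eventually_norm_iteratedFDerivWithin_le hG (j := 1) (by lia),
    hf.eventually_norm_iteratedFDerivWithin_le hG (j := 2) (by lia),
    hf.eventually_norm_iteratedFDerivWithin_le hG (j := 3) hp] with M h0 h1 h2 h3 t ht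
  constructor
  case contDiffOn =>
    have hcont := hf.contDiffOn_space 0 (by lia) t ht
    simp only [iteratedDerivWithin_zero, mul_zero, tsub_zero] at hcont
    exact hcont.of_le (by exact_mod_cast hp)
  case zero =>
    exact fun x hx => by simpa only [norm_iteratedFDerivWithin_zero] using h0 t ht x hx
  case one =>
    exact fun x hx => (norm_iteratedFDerivWithin_one _ (hS x hx)).symm.trans_le (h1 t ht x hx)
  case two =>
    intro x hx
    rw [sndDeriv, ← norm_iteratedFDerivWithin_one _ (hS x hx),
      norm_iteratedFDerivWithin_fderivWithin hS hx]
    exact h2 t ht x hx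
  case three =>
    intro x hx
    rw [← norm_iteratedFDerivWithin_one _ (hS x hx), norm_iteratedFDerivWithin_fderivWithin hS hx,
      norm_iteratedFDerivWithin_fderivWithin hS hx]
    exact h3 t ht x hx

theorem eventually_abs_sub_sub_mul_derivWithin_le (hf : MemParabolicHolder T G p ε f)
    (hT : 0 < T) (hG : Bornology.IsBounded G) (hp : 4 ≤ p) :
    ∀ᶠ M in atTop, ∀ x ∈ closure G, ∀ s ∈ Icc 0 T, ∀ t ∈ Icc 0 T,
      |f t x - f s x - (t - s) * derivWithin (fun s => f s x) (Icc 0 T) s| ≤ M * (t - s) ^ 2 := by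
  filter_upwards [hf.eventually_abs_iteratedDerivWithin_le hG (i := 2) (by lia)]
    with M h2 x hx s hs t ht
  have hp' : 2 ≤ p / 2 := by lia
  exact norm_sub_sub_smul_derivWithin_le (convex_Icc 0 T) (uniqueDiffOn_Icc hT)
    ((hf.contDiffOn_time x hx).of_le (by exact_mod_cast hp')) (fun r hr => h2 r hr x hx) hs ht

end MemParabolicHolder

theorem MemParabolicHolderBoundary.eventually_abs_le (hf : MemParabolicHolderBoundary T G p ε f)
    (hG : Bornology.IsBounded G) :
    ∀ᶠ M in atTop, ∀ t ∈ Icc 0 T, ∀ z ∈ frontier G, |f t z| ≤ M := by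
  obtain ⟨F, hF, hFf⟩ := hf
  filter_upwards [hF.eventually_abs_iteratedDerivWithin_le hG (i := 0) (by lia)] with M hM t ht z hz
  rw [← hFf t ht z hz]
  simpa only [iteratedDerivWithin_zero] using hM t ht z (frontier_subset_closure hz)

theorem MemHolderBoundary.eventually_le_and_one_le_mul {f : Space d → ℝ}
    (hf : MemHolderBoundary G p ε f) (hG : Bornology.IsBounded G)
    (hpos : ∀ z ∈ frontier G, 0 < f z) :
    ∀ᶠ M in atTop, ∀ z ∈ frontier G, f z ≤ M ∧ 1 ≤ M * f z := by
  obtain ⟨F, hF, hFf⟩ := hf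
  have hcont : ContinuousOn f (frontier G) :=
    (hF.contDiffOn.continuousOn.mono frontier_subset_closure).congr hFf.symm
  have hcomp : IsCompact (frontier G) :=
    hG.isCompact_closure.of_isClosed_subset isClosed_frontier frontier_subset_closure
  obtain ⟨C, hC⟩ := hcomp.exists_bound_of_continuousOn hcont
  obtain ⟨C', hC'⟩ := hcomp.exists_bound_of_continuousOn (hcont.inv₀ fun z hz => (hpos z hz).ne')
  filter_upwards [eventually_ge_atTop C, eventually_ge_atTop C'] with M hCM hCM' z hz
  refine ⟨(le_abs_self _).trans ((hC z hz).trans hCM), ?_⟩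
  rw [← inv_le_iff_one_le_mul₀ (hpos z hz)]
  exact (le_abs_self _).trans ((hC' z hz).trans hCM')

end DataBounds

/-- The `j`-th column of the diffusion matrix: the direction in which the `j`-th component of the
noise acts. -/
def Problem.noise (P : Problem d) (t : ℝ) (x : Space d) (j : Fin d) : Space d :=
  WithLp.toLp 2 fun i => P.σ t x i j

/-- A common bound `M` for the coefficients and for the derivatives of `u` which enter the error
estimate; the coefficient of stickiness is also bounded below by `1 / M`. -/
structure UniformBounds (P : Problem d) (u : ℝ → Space d → ℝ) (M : ℝ) : Prop where
  one_le : 1 ≤ M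
  deriv : ∀ t ∈ Icc 0 P.T, HasDerivBound (closure P.G) M (u t)
  lipschitz_time : HasTimeLipschitzBound P.T P.G M u
  taylor_time : ∀ x ∈ closure P.G, ∀ s ∈ Icc 0 P.T, ∀ t ∈ Icc 0 P.T,
    |u t x - u s x - (t - s) * derivWithin (fun s => u s x) (Icc 0 P.T) s| ≤ M * (t - s) ^ 2
  deriv_time : ∀ t ∈ Icc 0 P.T, ∀ x ∈ closure P.G,
    |derivWithin (fun s => u s x) (Icc 0 P.T) t| ≤ M
  b_bound : HasTimeLipschitzBound P.T P.G M P.b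
  noise_bound : ∀ j, HasTimeLipschitzBound P.T P.G M (fun t x => P.noise t x j)
  c_bound : HasTimeLipschitzBound P.T P.G M P.c
  g_bound : HasTimeLipschitzBound P.T P.G M P.g
  μ_bound : ∀ z ∈ frontier P.G, P.μ z ≤ M ∧ 1 ≤ M * P.μ z
  γ_bound : ∀ t ∈ Icc 0 P.T, ∀ z ∈ frontier P.G, |P.γ t z| ≤ M
  ψ_bound : ∀ t ∈ Icc 0 P.T, ∀ z ∈ frontier P.G, |P.ψ t z| ≤ M

theorem Problem.IsSolution.exists_uniformBounds {P : Problem d} {ε : ℝ≥0} {ν : Space d → Space d}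
    {u : ℝ → Space d → ℝ} (hu : P.IsSolution ε ν u) (hP : P.IsAdmissible ε) :
    ∃ M, UniformBounds P u M := by
  have hG := hP.isBounded
  have hS : UniqueDiffOn ℝ (closure P.G) := uniqueDiffOn_closure hP.isOpen fun z hz =>
    have ⟨U, ρ, hzU, hρ, _⟩ := hP.boundary z hz
    ⟨_, IsInwardUnitNormal.hasInwardCones ⟨U, ρ, hzU, hρ, rfl⟩⟩
  refine Eventually.exists (f := atTop) ?_
  filter_upwards [eventually_ge_atTop 1, hu.regular.eventually_hasDerivBound hG hS (by lia),
    hu.regular.eventually_hasTimeLipschitzBound hG (by lia),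
    hu.regular.eventually_abs_sub_sub_mul_derivWithin_le hP.T_pos hG le_rfl,
    hu.regular.eventually_abs_iteratedDerivWithin_le hG (i := 1) (by lia),
    MemParabolicHolder.eventually_hasTimeLipschitzBound_of_coord hP.b_mem hG le_rfl,
    eventually_all.2 fun j => MemParabolicHolder.eventually_hasTimeLipschitzBound_of_coord
      (f := fun t x => P.noise t x j) (fun i => hP.σ_mem i j) hG le_rfl,
    hP.c_mem.eventually_hasTimeLipschitzBound hG le_rfl,
    hP.g_mem.eventually_hasTimeLipschitzBound hG le_rfl,
    hP.μ_mem.eventually_le_and_one_le_mul hG hP.μ_pos, hP.γ_mem.eventually_abs_le hG,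
    hP.ψ_mem.eventually_abs_le hG]
    with M hM hderiv hlip htaylor hdt hb hσ hc hg hμ hγ hψ
  simp only [iteratedDerivWithin_one] at hdt
  exact ⟨hM, hderiv, hlip, htaylor, hdt, hb, hσ, hc, hg, hμ, hγ, hψ⟩

/-! ### Averages over signs -/

section Signs

variable {ι : Type*}

/-- The vector of signs coded by a Boolean vector. -/
def signs (e : ι → Bool) (i : ι) : ℝ := if e i then 1 else -1

theorem abs_signs (e : ι → Bool) (i : ι) : |signs e i| = 1 := by
  unfold signs; split <;> simp

theorem signs_mul_self (e : ι → Bool) (i : ι) : signs e i * signs e i = 1 := by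
  rw [← abs_mul_abs_self, abs_signs, one_mul]

variable {E : Type*} [NormedAddCommGroup E] [NormedSpace ℝ E]

theorem norm_sum_signs_smul_le [Fintype ι] (e : ι → Bool) (v : ι → E) :
    ‖∑ i, signs e i • v i‖ ≤ ∑ i, ‖v i‖ :=
  (norm_sum_le _ _).trans_eq <| Finset.sum_congr rfl fun i _ => by
    rw [norm_smul, Real.norm_eq_abs, abs_signs, one_mul]

theorem abs_expect_le_of_abs_le {κ : Type*} [Fintype κ] [Nonempty κ] {F : κ → ℝ} {B : ℝ}
    (h : ∀ e, |F e| ≤ B) : |𝔼 e, F e| ≤ B :=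
  (Finset.abs_expect_le Finset.univ F).trans (Finset.expect_le Finset.univ_nonempty fun e _ => h e)

variable [DecidableEq ι]

/-- Flipping the `i`-th entry of a Boolean vector. -/
def flipAt (i : ι) : (ι → Bool) ≃ (ι → Bool) where
  toFun e := Function.update e i (!e i)
  invFun e := Function.update e i (!e i)
  left_inv e := by simp
  right_inv e := by simp

theorem signs_flipAt_self (i : ι) (e : ι → Bool) : signs (flipAt i e) i = -signs e i := by
  cases h : e i <;> simp [signs, flipAt, h]

theorem signs_flipAt_of_ne {i j : ι} (h : j ≠ i) (e : ι → Bool) :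
    signs (flipAt i e) j = signs e j := by
  simp [signs, flipAt, h]

variable [Fintype ι]

theorem expect_eq_zero_of_flipAt (i : ι) {F : (ι → Bool) → ℝ} (hF : ∀ e, F (flipAt i e) = -F e) :
    𝔼 e, F e = 0 := by
  have h : 𝔼 e, F e = 𝔼 e, -F e :=
    Fintype.expect_equiv (flipAt i) _ _ fun e => by rw [hF, neg_neg]
  rw [Finset.expect_neg_distrib] at h
  linarith

theorem expect_signs (i : ι) : 𝔼 e, signs e i = 0 :=
  expect_eq_zero_of_flipAt i fun e => signs_flipAt_self i e

theorem expect_signs_mul_signs (i j : ι) :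
    𝔼 e, signs e i * signs e j = if i = j then 1 else 0 := by
  split_ifs with hij
  · subst hij
    simp only [signs_mul_self, Fintype.expect_const]
  · exact expect_eq_zero_of_flipAt i fun e => by
      rw [signs_flipAt_self, signs_flipAt_of_ne (Ne.symm hij), neg_mul]

theorem expect_map_sum_signs_smul (A : E →L[ℝ] ℝ) (v : ι → E) :
    𝔼 e, A (∑ i, signs e i • v i) = 0 := by
  simp only [map_sum, map_smul, smul_eq_mul, Finset.expect_sum_comm, ← Finset.expect_mul,
    expect_signs, zero_mul, Finset.sum_const_zero]

theorem expect_bilin_sum_signs_smul (B : E →L[ℝ] E →L[ℝ] ℝ) (v : ι → E) :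
    𝔼 e, B (∑ i, signs e i • v i) (∑ i, signs e i • v i) = ∑ i, B (v i) (v i) := by
  have hexpand : ∀ e : ι → Bool, B (∑ i, signs e i • v i) (∑ i, signs e i • v i) =
      ∑ i, ∑ j, signs e j * signs e i * B (v j) (v i) := fun e => by
    simp only [map_sum, map_smul, sum_apply, smul_apply, smul_eq_mul, Finset.mul_sum]
    exact Finset.sum_congr rfl fun i _ => Finset.sum_congr rfl fun j _ => by ring
  simp only [hexpand, Finset.expect_sum_comm, ← Finset.expect_mul, expect_signs_mul_signs, ite_mul,
    one_mul, zero_mul, Finset.sum_ite_eq', Finset.mem_univ, if_true]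

end Signs

/-! ### The Euler increment -/

section EulerIncrement

variable {E ι : Type*} [NormedAddCommGroup E] [NormedSpace ℝ E] [Fintype ι] {S : Set E}
  {x : E} {h : ℝ}

/-- The increment of the position in an Euler step with drift `b` and independent signs acting in
the directions `v i`. -/
def eulerIncrement (h : ℝ) (b : E) (v : ι → E) (e : ι → Bool) : E :=
  h • b + √h • ∑ i, signs e i • v i

theorem norm_eulerIncrement_le (hh : h ∈ Icc 0 1) {b : E} {v : ι → E} {M : ℝ} (hb : ‖b‖ ≤ M)
    (hv : ∀ i, ‖v i‖ ≤ M) (e : ι → Bool) :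
    ‖eulerIncrement h b v e‖ ≤ (1 + Fintype.card ι) * M * √h := by
  have hsum : ‖∑ i, signs e i • v i‖ ≤ Fintype.card ι * M :=
    (norm_sum_signs_smul_le e v).trans <|
      (Finset.sum_le_card_nsmul _ _ M fun i _ => hv i).trans_eq (by simp)
  calc ‖eulerIncrement h b v e‖ ≤ h * ‖b‖ + √h * ‖∑ i, signs e i • v i‖ := by
        refine (norm_add_le _ _).trans_eq ?_
        rw [norm_smul, norm_smul, Real.norm_of_nonneg hh.1,
          Real.norm_of_nonneg (Real.sqrt_nonneg h)]
    _ ≤ √h * M + √h * (Fintype.card ι * M) := by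
        gcongr
        exact Real.le_sqrt_self_iff.2 hh.2
    _ = (1 + Fintype.card ι) * M * √h := by ring

/-- The generator `D_b f + ½ ∑ᵢ D²_{vᵢ vᵢ} f` of a diffusion with drift `b` and noise directions
`vᵢ`, where derivatives are taken within `S`. -/
def diffusionGenerator (S : Set E) (b : E) (v : ι → E) (f : E → ℝ) (x : E) : ℝ :=
  fderivWithin ℝ f S x b + 1 / 2 * ∑ i, sndDeriv S f x (v i) (v i)

theorem abs_diffusionGenerator_sub_le {f : E → ℝ} {M δ : ℝ}
    (hf₁ : ‖fderivWithin ℝ f S x‖ ≤ M) (hf₂ : ‖sndDeriv S f x‖ ≤ M) {b b' : E}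
    (hb : ‖b - b'‖ ≤ δ) {v v' : ι → E} (hv : ∀ i, ‖v i‖ ≤ M) (hv' : ∀ i, ‖v' i‖ ≤ M)
    (hvv' : ∀ i, ‖v i - v' i‖ ≤ δ) :
    |diffusionGenerator S b v f x - diffusionGenerator S b' v' f x| ≤
      (M + Fintype.card ι * M ^ 2) * δ := by
  set A := fderivWithin ℝ f S x
  set B := sndDeriv S f x
  have hdrift : ‖A (b - b')‖ ≤ M * δ := A.le_of_opNorm_le_of_le hf₁ hb
  have hnoise : ∀ i, ‖B (v i - v' i) (v i) + B (v' i) (v i - v' i)‖ ≤ 2 * (M ^ 2 * δ) := fun i => by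
    refine (norm_add_le_of_le
      ((B (v i - v' i)).le_of_opNorm_le_of_le (B.le_of_opNorm_le_of_le hf₂ (hvv' i)) (hv i))
      ((B (v' i)).le_of_opNorm_le_of_le (B.le_of_opNorm_le_of_le hf₂ (hv' i)) (hvv' i))).trans_eq ?_
    ring
  have hsub : diffusionGenerator S b v f x - diffusionGenerator S b' v' f x =
      A (b - b') + 1 / 2 * ∑ i, (B (v i - v' i) (v i) + B (v' i) (v i - v' i)) := by
    simp only [diffusionGenerator, map_sub, sub_apply, sub_add_sub_cancel, Finset.sum_sub_distrib]
    ring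
  rw [hsub, ← Real.norm_eq_abs]
  calc ‖A (b - b') + 1 / 2 * ∑ i, (B (v i - v' i) (v i) + B (v' i) (v i - v' i))‖
      ≤ M * δ + 1 / 2 * ∑ _i : ι, 2 * (M ^ 2 * δ) := by
        refine norm_add_le_of_le hdrift ?_
        rw [norm_mul, Real.norm_of_nonneg (by norm_num)]
        gcongr
        exact norm_sum_le_of_le _ fun i _ => hnoise i
    _ = (M + Fintype.card ι * M ^ 2) * δ := by
        rw [Finset.sum_const, Finset.card_univ, nsmul_eq_mul]
        ring

theorem expect_taylorTwo_eulerIncrement [DecidableEq ι] (hh : 0 ≤ h) (S : Set E) (f : E → ℝ)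
    (x b : E) (v : ι → E) :
    𝔼 e, taylorTwo S f x (x + eulerIncrement h b v e) =
      f x + h * diffusionGenerator S b v f x + 1 / 2 * h ^ 2 * sndDeriv S f x b b := by
  set A := fderivWithin ℝ f S x
  set B := sndDeriv S f x
  have hexpand : ∀ e, taylorTwo S f x (x + eulerIncrement h b v e) =
      (f x + h * A b + 1 / 2 * h ^ 2 * B b b) +
        (√h • A + (1 / 2 * h * √h) • (B b + B.flip b)) (∑ i, signs e i • v i) +
        1 / 2 * h * B (∑ i, signs e i • v i) (∑ i, signs e i • v i) := fun e => by
    rw [taylorTwo, eulerIncrement, add_sub_cancel_left]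
    generalize ∑ i, signs e i • v i = w
    simp only [map_add, map_smul, add_apply, smul_apply, smul_eq_mul,
      ContinuousLinearMap.flip_apply]
    linear_combination (1 / 2 * B w w) * Real.mul_self_sqrt hh
  simp only [hexpand, Finset.expect_add_distrib, Fintype.expect_const, expect_map_sum_signs_smul,
    ← Finset.mul_expect, expect_bilin_sum_signs_smul, add_zero]
  rw [diffusionGenerator]
  ring

theorem abs_expect_taylorExtension_eulerIncrement_sub_le [DecidableEq ι] {f : E → ℝ} {C M : ℝ}
    (hfC : TaylorCompatible S C f) (hC : 0 ≤ C) (hx : x ∈ S) (hf₂ : ‖sndDeriv S f x‖ ≤ M)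
    {π : E → E} (hπ : ∀ y ∉ S, π y ∈ S ∧ ‖y - π y‖ ≤ ‖y - x‖) (hh : h ∈ Icc 0 1) {b : E}
    {v : ι → E} (hb : ‖b‖ ≤ M) (hv : ∀ i, ‖v i‖ ≤ M) :
    |𝔼 e, taylorExtension S π f (x + eulerIncrement h b v e) -
        (f x + h * diffusionGenerator S b v f x)| ≤
      (27 * C * ((1 + Fintype.card ι) * M) ^ 3 + M ^ 3) * (√h * h) := by
  have hM : 0 ≤ M := (norm_nonneg _).trans hb
  have hextension : |𝔼 e, (taylorExtension S π f (x + eulerIncrement h b v e) -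
      taylorTwo S f x (x + eulerIncrement h b v e))| ≤
      27 * C * ((1 + Fintype.card ι) * M) ^ 3 * (√h * h) := by
    refine abs_expect_le_of_abs_le fun e => ?_
    calc _ ≤ 27 * C * ‖x + eulerIncrement h b v e - x‖ ^ 3 :=
          hfC.norm_taylorExtension_sub_taylorTwo_le hC hx (hπ _)
      _ ≤ 27 * C * ((1 + Fintype.card ι) * M * √h) ^ 3 := by
          rw [add_sub_cancel_left]
          gcongr
          exact norm_eulerIncrement_le hh hb hv e
      _ = 27 * C * ((1 + Fintype.card ι) * M) ^ 3 * (√h * h) := by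
          linear_combination 27 * C * ((1 + Fintype.card ι) * M) ^ 3 * √h * Real.mul_self_sqrt hh.1
  have hdrift : |1 / 2 * h ^ 2 * sndDeriv S f x b b| ≤ M ^ 3 * (√h * h) := by
    have hB : |sndDeriv S f x b b| ≤ M * M * M :=
      (sndDeriv S f x b).le_of_opNorm_le_of_le ((sndDeriv S f x).le_of_opNorm_le_of_le hf₂ hb) hb
    rw [abs_mul, abs_of_nonneg (by positivity)]
    calc 1 / 2 * h ^ 2 * |sndDeriv S f x b b| ≤ 1 * h ^ 2 * (M * M * M) := by gcongr; norm_num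
      _ = M ^ 3 * (h * h) := by ring
      _ ≤ M ^ 3 * (√h * h) := by
          have := hh.1
          gcongr
          exact Real.le_sqrt_self_iff.2 hh.2
  rw [Finset.expect_sub_distrib, expect_taylorTwo_eulerIncrement hh.1] at hextension
  rw [add_mul]
  refine le_trans ?_ (add_le_add hextension hdrift)
  exact (abs_add_le _ _).trans_eq' (by ring_nf)

end EulerIncrement

theorem toLp_mulVec_eq_sum_noise (P : Problem d) (t : ℝ) (x : Space d) (ξ : Fin d → ℝ) :
    (WithLp.toLp 2 ((P.σ t x).mulVec ξ) : Space d) = ∑ j, ξ j • P.noise t x j := by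
  ext i
  simp [Problem.noise, Matrix.mulVec, dotProduct, mul_comm]

theorem Problem.sum_noise_noise (P : Problem d) (B : Space d →L[ℝ] Space d →L[ℝ] ℝ) (t : ℝ)
    (x : Space d) :
    ∑ j, B (P.noise t x j) (P.noise t x j) = ∑ i, ∑ k, (P.σ t x * (P.σ t x).transpose) i k *
      B (EuclideanSpace.single i 1) (EuclideanSpace.single k 1) := by
  have hexpand : ∀ j, B (P.noise t x j) (P.noise t x j) = ∑ i, ∑ k, P.σ t x i j * P.σ t x k j *
      B (EuclideanSpace.single i 1) (EuclideanSpace.single k 1) := fun j => by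
    conv_lhs => rw [← sum_smul_single (P.noise t x j)]
    simp only [map_sum, map_smul, sum_apply, smul_apply, smul_eq_mul, Finset.mul_sum, mul_assoc,
      Problem.noise]
    rw [Finset.sum_comm]
    simp only [mul_left_comm]
  simp only [hexpand, Matrix.mul_apply, Matrix.transpose_apply, Finset.sum_mul]
  rw [Finset.sum_comm]
  exact Finset.sum_congr rfl fun i _ => Finset.sum_comm

theorem Problem.generator_eq_diffusionGenerator (P : Problem d)
    (hS : UniqueDiffOn ℝ (closure P.G)) (u : ℝ → Space d → ℝ) (t : ℝ) {x : Space d}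
    (hx : x ∈ closure P.G) :
    P.generator u t x = diffusionGenerator (closure P.G) (P.b t x) (P.noise t x) (u t) x := by
  rw [Problem.generator, diffusionGenerator, P.sum_noise_noise, ← sum_smul_single (P.b t x),
    map_sum, add_comm]
  simp only [iteratedFDerivWithin_two_apply _ hS hx, Matrix.cons_val_zero, Matrix.cons_val_one,
    map_smul, smul_eq_mul, sum_smul_single]

/-! ### One step of the chain -/

theorem IsBoundaryProjection.norm_sub_le {G : Set (Space d)} {π : Space d → Space d}
    (hπ : IsBoundaryProjection G π) {x y : Space d} (hx : x ∈ closure G) (hy : y ∉ closure G) :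
    ‖y - π y‖ ≤ ‖y - x‖ := by
  simpa only [← dist_eq_norm, (hπ y hy).2] using infDist_frontier_le_dist hx hy

open Classical in
/-- The time increment of a step from the position `x`. -/
def Problem.duration (P : Problem d) (π : Space d → Space d) (h : ℝ) (x : Space d) : ℝ :=
  if x ∈ closure P.G then h else infDist x (frontier P.G) * P.μ (π x)

open Classical in
/-- The position after a step from `(t, x)` with noise `ξ`. -/
def Problem.nextPosition (P : Problem d) (π : Space d → Space d) (h : ℝ) (ξ : Fin d → ℝ) (t : ℝ)
    (x : Space d) : Space d :=
  if x ∈ closure P.G then x + h • P.b t x + √h • WithLp.toLp 2 ((P.σ t x).mulVec ξ) else π x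

open Classical in
/-- The factor by which a step from `(t, x)` multiplies the weight `Y`. -/
def Problem.growth (P : Problem d) (π : Space d → Space d) (h t : ℝ) (x : Space d) : ℝ :=
  if x ∈ closure P.G then 1 + h * P.c t x
  else 1 + infDist x (frontier P.G) * (P.γ t (π x) + P.μ (π x) * P.c t (π x))

open Classical in
/-- The increment of the functional `Z` in a step from `(t, x)` with weight `1`. -/
def Problem.gain (P : Problem d) (π : Space d → Space d) (h t : ℝ) (x : Space d) : ℝ :=
  if x ∈ closure P.G then h * P.g t x
  else infDist x (frontier P.G) * (P.μ (π x) * P.g t (π x) - P.ψ t (π x))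

/-- One step of the chain. -/
def Problem.step (P : Problem d) (π : Space d → Space d) (h : ℝ) (ξ : Fin d → ℝ)
    (s : ChainState d) : ChainState d where
  t := s.t + P.duration π h s.X
  X := P.nextPosition π h ξ s.t s.X
  Y := P.growth π h s.t s.X * s.Y
  Z := s.Z + P.gain π h s.t s.X * s.Y

theorem Problem.chain_succ (P : Problem d) (π : Space d → Space d) (h t₀ : ℝ) (x : Space d)
    (ξ : ℕ → Fin d → ℝ) (k : ℕ) :
    P.chain π h t₀ x ξ (k + 1) = P.step π h (ξ (k + 1)) (P.chain π h t₀ x ξ k) := by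
  rw [chain]
  by_cases hx : (P.chain π h t₀ x ξ k).X ∈ closure P.G
  · simp only [hx, if_true, step, duration, nextPosition, growth, gain, eulerStep,
      ChainState.mk.injEq, true_and, and_true]
    ring
  · simp only [hx, if_false, step, duration, nextPosition, growth, gain, projectionStep,
      ChainState.mk.injEq, true_and]
    constructor <;> ring

theorem Problem.nextPosition_signs_of_mem {P : Problem d} {x : Space d} (hx : x ∈ closure P.G)
    (π : Space d → Space d) (h t : ℝ) (e : Fin d → Bool) :
    P.nextPosition π h (signs e) t x = x + eulerIncrement h (P.b t x) (P.noise t x) e := by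
  rw [nextPosition, if_pos hx, toLp_mulVec_eq_sum_noise, eulerIncrement, add_assoc]

theorem Problem.duration_nonneg {P : Problem d} {π : Space d → Space d}
    (hμ : ∀ z ∈ frontier P.G, 0 ≤ P.μ z) (hπ : IsBoundaryProjection P.G π) {h : ℝ} (hh : 0 ≤ h)
    (x : Space d) : 0 ≤ P.duration π h x := by
  unfold duration
  split_ifs with hx
  · exact hh
  · exact mul_nonneg infDist_nonneg (hμ _ (hπ x hx).1)

/-- The solution, extended to the exterior of the domain by its Taylor polynomials at the projected
points. -/
abbrev Problem.extension (P : Problem d) (π : Space d → Space d) (u : ℝ → Space d → ℝ) (t : ℝ) :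
    Space d → ℝ :=
  taylorExtension (closure P.G) π (u t)

/-- States from which the chain makes a step: the time is at most `T` and the position has left the
closed domain by at most `R * √h`. -/
structure Problem.IsRunning (P : Problem d) (R h t : ℝ) (x : Space d) : Prop where
  time_mem : t ∈ Icc 0 P.T
  infDist_le : x ∉ closure P.G → infDist x (frontier P.G) ≤ R * √h

/-- The estimates for a single step of the chain from which the error of the scheme is deduced. -/
structure StepEstimates (P : Problem d) (π : Space d → Space d) (u : ℝ → Space d → ℝ)
    (h R K : ℝ) : Prop where
  duration_nonneg : ∀ x, 0 ≤ P.duration π h x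
  growth_le : ∀ t x, P.IsRunning R h t x → |P.growth π h t x| ≤ Real.exp (K * P.duration π h x)
  isRunning_next : ∀ t x, P.IsRunning R h t x → t + P.duration π h x ≤ P.T →
    ∀ e, P.IsRunning R h (t + P.duration π h x) (P.nextPosition π h (signs e) t x)
  error : ∀ t x, P.IsRunning R h t x → t + P.duration π h x ≤ P.T →
    |(𝔼 e, P.extension π u (t + P.duration π h x) (P.nextPosition π h (signs e) t x)) *
      P.growth π h t x + P.gain π h t x - P.extension π u t x| ≤ K * (√h * P.duration π h x)
  final_error : ∀ t x, P.IsRunning R h t x → P.T < t + P.duration π h x → ∀ e,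
    |P.φ (P.nextPosition π h (signs e) t x) * P.growth π h t x + P.gain π h t x -
      P.extension π u t x| ≤ K * √h

/-! ### Local errors -/

/-- The equations of `Problem.IsSolution`, without the regularity of `u`. -/
structure Problem.SolvesEquations (P : Problem d) (ν : Space d → Space d)
    (u : ℝ → Space d → ℝ) : Prop where
  pde : ∀ t ∈ Icc 0 P.T, ∀ x ∈ closure P.G,
    derivWithin (fun s => u s x) (Icc 0 P.T) t + P.generator u t x
      + P.c t x * u t x + P.g t x = 0
  terminal : ∀ x ∈ closure P.G, u P.T x = P.φ x
  boundary : ∀ t ∈ Icc 0 P.T, ∀ z ∈ frontier P.G,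
    -(P.μ z * P.generator u t z) + fderivWithin ℝ (u t) (closure P.G) z (ν z)
      + P.γ t z * u t z = P.ψ t z

theorem Problem.IsSolution.solvesEquations {P : Problem d} {ε : ℝ≥0} {ν : Space d → Space d}
    {u : ℝ → Space d → ℝ} (hu : P.IsSolution ε ν u) : P.SolvesEquations ν u :=
  ⟨hu.pde, hu.terminal, hu.boundary⟩

namespace UniformBounds

variable {P : Problem d} {ν π : Space d → Space d} {u : ℝ → Space d → ℝ} {M C R h t : ℝ}
  {x : Space d}

theorem nonneg (hM : UniformBounds P u M) : 0 ≤ M := zero_le_one.trans hM.one_le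

theorem μ_nonneg (hM : UniformBounds P u M) {z : Space d} (hz : z ∈ frontier P.G) : 0 ≤ P.μ z :=
  (pos_of_mul_pos_right (zero_lt_one.trans_le (hM.μ_bound z hz).2) hM.nonneg).le

theorem infDist_le_mul_duration (hM : UniformBounds P u M) (hπ : IsBoundaryProjection P.G π)
    (h : ℝ) (hx : x ∉ closure P.G) : infDist x (frontier P.G) ≤ M * P.duration π h x := by
  rw [Problem.duration, if_neg hx, mul_left_comm]
  exact le_mul_of_one_le_right infDist_nonneg (hM.μ_bound _ (hπ x hx).1).2

/-- The part of the duration spent on the boundary dominates the reflection term `r`, so both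
contributions to a step are of the order of its duration. -/
theorem abs_mul_duration_add_mul_infDist_le (hM : UniformBounds P u M)
    (hπ : IsBoundaryProjection P.G π) (h : ℝ) (hx : x ∉ closure P.G) {a b : ℝ} (ha : |a| ≤ M)
    (hb : |b| ≤ M) :
    |a * P.duration π h x + b * infDist x (frontier P.G)| ≤ (M + M ^ 2) * P.duration π h x := by
  have hM₀ := hM.nonneg
  have hd : 0 ≤ P.duration π h x := by
    rw [Problem.duration, if_neg hx]
    exact mul_nonneg infDist_nonneg (hM.μ_nonneg (hπ x hx).1)
  refine (abs_add_le _ _).trans ?_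
  rw [abs_mul, abs_mul, abs_of_nonneg hd, abs_of_nonneg infDist_nonneg]
  calc |a| * P.duration π h x + |b| * infDist x (frontier P.G)
      ≤ M * P.duration π h x + M * (M * P.duration π h x) := by
        gcongr
        · exact infDist_nonneg
        · exact hM.infDist_le_mul_duration hπ h hx
    _ = (M + M ^ 2) * P.duration π h x := by ring

theorem abs_growth_sub_one_le (hM : UniformBounds P u M) (hπ : IsBoundaryProjection P.G π)
    (hh : 0 ≤ h) (ht : t ∈ Icc 0 P.T) (x : Space d) :
    |P.growth π h t x - 1| ≤ (M + M ^ 2) * P.duration π h x := by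
  by_cases hx : x ∈ closure P.G
  · rw [Problem.growth, Problem.duration, if_pos hx, if_pos hx, add_sub_cancel_left, mul_comm h]
    refine (norm_mul_le_of_le (hM.c_bound.norm_le t ht x hx) (Real.norm_of_nonneg hh).le).trans ?_
    gcongr
    exact le_add_of_nonneg_right (sq_nonneg M)
  · have hz := (hπ x hx).1
    refine (hM.abs_mul_duration_add_mul_infDist_le hπ h hx (hM.c_bound.norm_le t ht _
      (frontier_subset_closure hz)) (hM.γ_bound t ht _ hz)).trans_eq' ?_
    rw [Problem.growth, Problem.duration, if_neg hx, if_neg hx]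
    ring_nf

theorem abs_gain_le (hM : UniformBounds P u M) (hπ : IsBoundaryProjection P.G π)
    (hh : 0 ≤ h) (ht : t ∈ Icc 0 P.T) (x : Space d) :
    |P.gain π h t x| ≤ (M + M ^ 2) * P.duration π h x := by
  by_cases hx : x ∈ closure P.G
  · rw [Problem.gain, Problem.duration, if_pos hx, if_pos hx, mul_comm h]
    refine (norm_mul_le_of_le (hM.g_bound.norm_le t ht x hx) (Real.norm_of_nonneg hh).le).trans ?_
    gcongr
    exact le_add_of_nonneg_right (sq_nonneg M)
  · have hz := (hπ x hx).1
    refine (hM.abs_mul_duration_add_mul_infDist_le hπ h hx (hM.g_bound.norm_le t ht _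
      (frontier_subset_closure hz)) ((abs_neg _).trans_le (hM.ψ_bound t ht _ hz))).trans_eq' ?_
    rw [Problem.gain, Problem.duration, if_neg hx, if_neg hx]
    ring_nf

theorem abs_growth_le_exp (hM : UniformBounds P u M) (hπ : IsBoundaryProjection P.G π)
    (hh : 0 ≤ h) (ht : t ∈ Icc 0 P.T) (x : Space d) :
    |P.growth π h t x| ≤ Real.exp ((M + M ^ 2) * P.duration π h x) := by
  have habs := abs_sub_abs_le_abs_sub (P.growth π h t x) 1
  rw [abs_one] at habs
  linarith [hM.abs_growth_sub_one_le hπ hh ht x,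
    Real.add_one_le_exp ((M + M ^ 2) * P.duration π h x)]

theorem abs_generator_le (hM : UniformBounds P u M) (hu : P.SolvesEquations ν u)
    (ht : t ∈ Icc 0 P.T) (hx : x ∈ closure P.G) : |P.generator u t x| ≤ 2 * M + M ^ 2 := by
  have hcu : |P.c t x * u t x| ≤ M * M :=
    norm_mul_le_of_le (hM.c_bound.norm_le t ht x hx) (hM.lipschitz_time.norm_le t ht x hx)
  have hL : P.generator u t x =
      -(derivWithin (fun s => u s x) (Icc 0 P.T) t + P.c t x * u t x + P.g t x) := by
    linarith [hu.pde t ht x hx]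
  rw [hL, abs_neg]
  exact (norm_add_le_of_le (norm_add_le_of_le (hM.deriv_time t ht x hx) hcu)
    (hM.g_bound.norm_le t ht x hx)).trans_eq (by ring)

theorem abs_expect_extension_nextPosition_sub_le (hM : UniformBounds P u M)
    (hS : UniqueDiffOn ℝ (closure P.G)) (hC : 0 ≤ C) {t' : ℝ}
    (huC : TaylorCompatible (closure P.G) C (u t')) (hπ : IsBoundaryProjection P.G π)
    (hh : h ∈ Icc 0 1) (ht : t ∈ Icc 0 P.T) (ht' : t' ∈ Icc 0 P.T) (htt' : |t' - t| ≤ h)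
    (hx : x ∈ closure P.G) :
    |𝔼 e, P.extension π u t' (P.nextPosition π h (signs e) t x) -
        (u t' x + h * P.generator u t' x)| ≤
      (27 * C * ((1 + d) * M) ^ 3 + M ^ 3 + (M + d * M ^ 2) * M) * (√h * h) := by
  have hM₀ := hM.nonneg
  have hD := hM.deriv t' ht'
  have hfrozen := abs_expect_taylorExtension_eulerIncrement_sub_le huC hC hx (hD.two x hx)
    (fun y hy => ⟨frontier_subset_closure (hπ y hy).1, hπ.norm_sub_le hx hy⟩) hh
    (hM.b_bound.norm_le t ht x hx) fun j => (hM.noise_bound j).norm_le t ht x hx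
  have htime : |diffusionGenerator (closure P.G) (P.b t x) (P.noise t x) (u t') x -
      P.generator u t' x| ≤ (M + d * M ^ 2) * (M * h) := by
    have hδ : M * |t - t'| ≤ M * h := by gcongr; rwa [abs_sub_comm]
    rw [P.generator_eq_diffusionGenerator hS u t' hx]
    simpa only [Fintype.card_fin] using abs_diffusionGenerator_sub_le (hD.one x hx) (hD.two x hx)
      ((hM.b_bound.norm_sub_le t' ht' t ht x hx).trans hδ)
      (fun j => (hM.noise_bound j).norm_le t ht x hx)
      (fun j => (hM.noise_bound j).norm_le t' ht' x hx)
      fun j => ((hM.noise_bound j).norm_sub_le t' ht' t ht x hx).trans hδ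
  have hhh : h * h ≤ √h * h := mul_le_mul_of_nonneg_right (Real.le_sqrt_self_iff.2 hh.2) hh.1
  simp only [Problem.nextPosition_signs_of_mem hx]
  rw [Fintype.card_fin] at hfrozen
  calc _ = |(𝔼 e, P.extension π u t' (x + eulerIncrement h (P.b t x) (P.noise t x) e) -
          (u t' x + h * diffusionGenerator (closure P.G) (P.b t x) (P.noise t x) (u t') x)) +
          h * (diffusionGenerator (closure P.G) (P.b t x) (P.noise t x) (u t') x -
            P.generator u t' x)| := by ring_nf
    _ ≤ (27 * C * ((1 + d) * M) ^ 3 + M ^ 3) * (√h * h) + h * ((M + d * M ^ 2) * (M * h)) :=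
        norm_add_le_of_le hfrozen (norm_mul_le_of_le (Real.norm_of_nonneg hh.1).le htime)
    _ = (27 * C * ((1 + d) * M) ^ 3 + M ^ 3) * (√h * h) + (M + d * M ^ 2) * M * (h * h) := by ring
    _ ≤ (27 * C * ((1 + d) * M) ^ 3 + M ^ 3) * (√h * h) + (M + d * M ^ 2) * M * (√h * h) := by
        gcongr
    _ = _ := by ring

theorem abs_generator_step_error_le (hM : UniformBounds P u M) (hu : P.SolvesEquations ν u)
    (hh : 0 ≤ h) (ht : t ∈ Icc 0 P.T) (ht' : t + h ∈ Icc 0 P.T) (hx : x ∈ closure P.G) :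
    |(u (t + h) x + h * P.generator u (t + h) x) * (1 + h * P.c t x) + h * P.g t x - u t x| ≤
      (2 * M + 3 * M ^ 2 + M ^ 3) * h ^ 2 := by
  set U := u (t + h) x
  set D := derivWithin (fun s => u s x) (Icc 0 P.T) (t + h)
  set L := P.generator u (t + h) x
  have hsub : |t - (t + h)| = h := by rw [sub_add_cancel_left, abs_neg, abs_of_nonneg hh]
  have hcU : |(P.c t x - P.c (t + h) x) * U| ≤ M * h * M :=
    norm_mul_le_of_le ((hM.c_bound.norm_sub_le _ ht' _ ht x hx).trans_eq (by rw [hsub]))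
      (hM.lipschitz_time.norm_le _ ht' x hx)
  have hg : |P.g t x - P.g (t + h) x| ≤ M * h :=
    (hM.g_bound.norm_sub_le _ ht' _ ht x hx).trans_eq (by rw [hsub])
  have hcL : |P.c t x * L| ≤ M * (2 * M + M ^ 2) :=
    norm_mul_le_of_le (hM.c_bound.norm_le t ht x hx) (hM.abs_generator_le hu ht' hx)
  have htaylor : |u t x - U + h * D| ≤ M * h ^ 2 := by
    have := hM.taylor_time x hx _ ht' _ ht
    rwa [sub_add_cancel_left, neg_sq, neg_mul, sub_neg_eq_add] at this
  have hpde : D + L + P.c (t + h) x * U + P.g (t + h) x = 0 := hu.pde _ ht' x hx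
  calc |(U + h * L) * (1 + h * P.c t x) + h * P.g t x - u t x|
      = |h * ((P.c t x - P.c (t + h) x) * U + (P.g t x - P.g (t + h) x)) +
          h ^ 2 * (P.c t x * L) - (u t x - U + h * D)| := by
        congr 1
        linear_combination h * hpde
    _ ≤ h * (M * h * M + M * h) + h ^ 2 * (M * (2 * M + M ^ 2)) + M * h ^ 2 :=
        norm_sub_le_of_le (norm_add_le_of_le (norm_mul_le_of_le (Real.norm_of_nonneg hh).le
          (norm_add_le_of_le hcU hg))
          (norm_mul_le_of_le (Real.norm_of_nonneg (sq_nonneg h)).le hcL))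
          htaylor
    _ = (2 * M + 3 * M ^ 2 + M ^ 3) * h ^ 2 := by ring

theorem abs_euler_error_le (hM : UniformBounds P u M) (hu : P.SolvesEquations ν u)
    (hS : UniqueDiffOn ℝ (closure P.G)) (hC : 0 ≤ C)
    (huC : TaylorCompatible (closure P.G) C (u (t + h))) (hπ : IsBoundaryProjection P.G π)
    (hh : h ∈ Icc 0 1) (ht : t ∈ Icc 0 P.T) (ht' : t + h ∈ Icc 0 P.T) (hx : x ∈ closure P.G) :
    |(𝔼 e, P.extension π u (t + h) (P.nextPosition π h (signs e) t x)) * (1 + h * P.c t x) +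
        h * P.g t x - u t x| ≤
      ((27 * C * ((1 + d) * M) ^ 3 + M ^ 3 + (M + d * M ^ 2) * M) * (1 + M) +
        (2 * M + 3 * M ^ 2 + M ^ 3)) * (√h * h) := by
  have hM₀ := hM.nonneg
  have hh₀ := hh.1
  set K := 27 * C * ((1 + d) * M) ^ 3 + M ^ 3 + (M + d * M ^ 2) * M
  set V := 𝔼 e, P.extension π u (t + h) (P.nextPosition π h (signs e) t x)
  set W := u (t + h) x + h * P.generator u (t + h) x
  have hV : |V - W| ≤ K * (√h * h) :=
    hM.abs_expect_extension_nextPosition_sub_le hS hC huC hπ hh ht ht'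
      (by rw [add_sub_cancel_left, abs_of_nonneg hh₀]) hx
  have hW : |W * (1 + h * P.c t x) + h * P.g t x - u t x| ≤
      (2 * M + 3 * M ^ 2 + M ^ 3) * (√h * h) := by
    refine (hM.abs_generator_step_error_le hu hh₀ ht ht' hx).trans ?_
    rw [sq h]
    gcongr
    exact Real.le_sqrt_self_iff.2 hh.2
  have hfactor : |1 + h * P.c t x| ≤ 1 + 1 * M :=
    norm_add_le_of_le norm_one.le (norm_mul_le_of_le ((Real.norm_of_nonneg hh₀).trans_le hh.2)
      (hM.c_bound.norm_le t ht x hx))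
  calc |V * (1 + h * P.c t x) + h * P.g t x - u t x|
      = |(V - W) * (1 + h * P.c t x) + (W * (1 + h * P.c t x) + h * P.g t x - u t x)| := by
        congr 1
        ring
    _ ≤ K * (√h * h) * (1 + 1 * M) + (2 * M + 3 * M ^ 2 + M ^ 3) * (√h * h) :=
        (abs_add_le _ _).trans (add_le_add ((abs_mul _ _).trans_le (by gcongr)) hW)
    _ = (K * (1 + M) + (2 * M + 3 * M ^ 2 + M ^ 3)) * (√h * h) := by ring

theorem abs_extension_sub_add_le (hM : UniformBounds P u M) (hπ : IsBoundaryProjection P.G π)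
    (hν : HasInwardCones P.G (π x) (ν (π x))) (ht : t ∈ Icc 0 P.T) (hx : x ∉ closure P.G) :
    |P.extension π u t x - u t (π x) + infDist x (frontier P.G) *
        fderivWithin ℝ (u t) (closure P.G) (π x) (ν (π x))| ≤
      M * infDist x (frontier P.G) ^ 2 := by
  have hz := frontier_subset_closure (hπ x hx).1
  have htaylor := (hM.deriv t ht).norm_taylorTwo_sub_sub_le hz x
  rw [hν.sub_eq_of_dist_eq_infDist hz hx (hπ x hx).2, norm_smul, hν.norm_eq_one, mul_one, norm_neg,
    Real.norm_of_nonneg infDist_nonneg, map_smul, smul_eq_mul, neg_mul, sub_neg_eq_add] at htaylor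
  rwa [Problem.extension, taylorExtension_of_notMem hx]

theorem abs_extension_sub_le (hM : UniformBounds P u M) (hπ : IsBoundaryProjection P.G π)
    (hν : HasInwardCones P.G (π x) (ν (π x))) (ht : t ∈ Icc 0 P.T) (hx : x ∉ closure P.G) :
    |P.extension π u t x - u t (π x)| ≤
      M * (infDist x (frontier P.G) + infDist x (frontier P.G) ^ 2) := by
  have htaylor := hM.abs_extension_sub_add_le hπ hν ht hx
  have hr : 0 ≤ infDist x (frontier P.G) := infDist_nonneg
  set r := infDist x (frontier P.G)
  set N := fderivWithin ℝ (u t) (closure P.G) (π x) (ν (π x))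
  have hN : |N| ≤ M * 1 := ContinuousLinearMap.le_of_opNorm_le_of_le _
    ((hM.deriv t ht).one _ (frontier_subset_closure (hπ x hx).1)) hν.norm_eq_one.le
  have hrN : |r * N| ≤ r * M := by
    rw [abs_mul, abs_of_nonneg hr, ← mul_one M]
    gcongr
  calc |P.extension π u t x - u t (π x)|
      = |(P.extension π u t x - u t (π x) + r * N) - r * N| := by rw [add_sub_cancel_right]
    _ ≤ M * r ^ 2 + r * M := (norm_sub_le (E := ℝ) _ _).trans (add_le_add htaylor hrN)
    _ = M * (r + r ^ 2) := by ring

theorem abs_projection_error_le (hM : UniformBounds P u M) (hu : P.SolvesEquations ν u)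
    (hπ : IsBoundaryProjection P.G π) (hν : HasInwardCones P.G (π x) (ν (π x)))
    (hr : infDist x (frontier P.G) ≤ R) (ht : t ∈ Icc 0 P.T)
    (ht' : t + P.duration π h x ∈ Icc 0 P.T) (hx : x ∉ closure P.G) :
    |u (t + P.duration π h x) (π x) * P.growth π h t x + P.gain π h t x - P.extension π u t x| ≤
      (M ^ 3 * (1 + R * (M + M ^ 2)) + M ^ 2 * (M + M ^ 2) + M) *
        infDist x (frontier P.G) ^ 2 := by
  have hz := (hπ x hx).1
  have hz' := frontier_subset_closure hz
  have hextension := hM.abs_extension_sub_add_le hπ hν ht hx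
  have hμ : |P.μ (π x)| ≤ M :=
    (abs_of_nonneg (hM.μ_nonneg hz)).trans_le (hM.μ_bound _ hz).1
  have hr₀ : |infDist x (frontier P.G)| = infDist x (frontier P.G) := abs_of_nonneg infDist_nonneg
  have htaylor := hM.taylor_time (π x) hz' t ht _ ht'
  rw [Problem.growth, Problem.gain, if_neg hx, if_neg hx]
  rw [add_sub_cancel_left] at htaylor
  rw [Problem.duration, if_neg hx] at htaylor ⊢
  set r := infDist x (frontier P.G)
  set z := π x
  set m := P.μ z
  set w := P.γ t z + m * P.c t z
  set D := derivWithin (fun s => u s z) (Icc 0 P.T) t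
  set N := fderivWithin ℝ (u t) (closure P.G) z (ν z)
  have hw : |w| ≤ M + M * M :=
    norm_add_le_of_le (hM.γ_bound t ht z hz) (norm_mul_le_of_le hμ (hM.c_bound.norm_le t ht z hz'))
  have hfactor : |1 + r * w| ≤ 1 + R * (M + M * M) :=
    (abs_add_le _ _).trans (add_le_add abs_one.le (norm_mul_le_of_le (α := ℝ) (hr₀.trans_le hr) hw))
  have hm : |r ^ 2 * (m * m)| ≤ r ^ 2 * (M * M) :=
    norm_mul_le_of_le (Real.norm_of_nonneg (sq_nonneg r)).le (norm_mul_le_of_le hμ hμ)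
  have htaylor' : |u (t + r * m) z - u t z - r * m * D| ≤ M * (r ^ 2 * (M * M)) :=
    htaylor.trans (mul_le_mul_of_nonneg_left ((le_abs_self _).trans (hm.trans_eq' (by ring_nf)))
      hM.nonneg)
  calc |u (t + r * m) z * (1 + r * w) + r * (m * P.g t z - P.ψ t z) - P.extension π u t x|
      = |(u (t + r * m) z - u t z - r * m * D) * (1 + r * w) + r ^ 2 * (m * D * w) -
          (P.extension π u t x - u t z + r * N)| := by
        congr 1
        linear_combination r * m * hu.pde t ht z hz' + r * hu.boundary t ht z hz
    _ ≤ M * (r ^ 2 * (M * M)) * (1 + R * (M + M * M)) + r ^ 2 * (M * M * (M + M * M)) +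
          M * r ^ 2 :=
        norm_sub_le_of_le (norm_add_le_of_le (norm_mul_le_of_le htaylor' hfactor)
          (norm_mul_le_of_le (Real.norm_of_nonneg (sq_nonneg r)).le (norm_mul_le_of_le
          (norm_mul_le_of_le hμ (hM.deriv_time t ht z hz')) hw))) hextension
    _ = (M ^ 3 * (1 + R * (M + M ^ 2)) + M ^ 2 * (M + M ^ 2) + M) * r ^ 2 := by ring

theorem norm_nextPosition_sub_le (hM : UniformBounds P u M) (hR : (1 + d) * M ≤ R)
    (π : Space d → Space d) (hh : h ∈ Icc 0 1) (ht : t ∈ Icc 0 P.T) (hx : x ∈ closure P.G)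
    (e : Fin d → Bool) : ‖P.nextPosition π h (signs e) t x - x‖ ≤ R * √h := by
  rw [Problem.nextPosition_signs_of_mem hx, add_sub_cancel_left]
  refine (norm_eulerIncrement_le hh (hM.b_bound.norm_le t ht x hx)
    (fun j => (hM.noise_bound j).norm_le t ht x hx) e).trans ?_
  rw [Fintype.card_fin]
  gcongr

theorem infDist_nextPosition_le (hM : UniformBounds P u M) (hR : (1 + d) * M ≤ R)
    (hπ : IsBoundaryProjection P.G π) (hh : h ∈ Icc 0 1) (ht : t ∈ Icc 0 P.T) {e : Fin d → Bool}
    (hnext : P.nextPosition π h (signs e) t x ∉ closure P.G) :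
    infDist (P.nextPosition π h (signs e) t x) (frontier P.G) ≤ R * √h := by
  by_cases hx : x ∈ closure P.G
  · refine (infDist_frontier_le_dist hx hnext).trans ?_
    rw [dist_eq_norm]
    exact hM.norm_nextPosition_sub_le hR π hh ht hx e
  · rw [Problem.nextPosition, if_neg hx] at hnext
    exact absurd (frontier_subset_closure (hπ x hx).1) hnext

theorem duration_le (hM : UniformBounds P u M) (hR : 0 ≤ R) (hπ : IsBoundaryProjection P.G π)
    (hh : h ∈ Icc 0 1) (hx : x ∉ closure P.G → infDist x (frontier P.G) ≤ R * √h) :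
    P.duration π h x ≤ (1 + R * M) * √h := by
  have hM₀ := hM.nonneg
  rw [Problem.duration, add_mul, one_mul]
  split_ifs with hxG
  · exact (Real.le_sqrt_self_iff.2 hh.2).trans (le_add_of_nonneg_right (by positivity))
  · calc infDist x (frontier P.G) * P.μ (π x) ≤ R * √h * M :=
          mul_le_mul (hx hxG) (hM.μ_bound _ (hπ x hxG).1).1 (hM.μ_nonneg (hπ x hxG).1)
            (by positivity)
      _ = R * M * √h := by ring
      _ ≤ √h + R * M * √h := le_add_of_nonneg_left (Real.sqrt_nonneg h)

/-- Both the next position and the current value of the extension are compared with the values at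
a point of the closed domain: the current position, or its projection. -/
theorem exists_mem_closure_abs_sub_le (hM : UniformBounds P u M) (hR : (1 + d) * M ≤ R) {L : ℝ≥0}
    (hL : LipschitzOnWith L P.φ (cthickening R (closure P.G))) (hπ : IsBoundaryProjection P.G π)
    (hν : ∀ z ∈ frontier P.G, HasInwardCones P.G z (ν z)) (hh : h ∈ Icc 0 1) (ht : t ∈ Icc 0 P.T)
    (hx : x ∉ closure P.G → infDist x (frontier P.G) ≤ R * √h) (e : Fin d → Bool) :
    ∃ p ∈ closure P.G, |P.φ (P.nextPosition π h (signs e) t x) - P.φ p| ≤ L * R * √h ∧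
      |P.extension π u t x - u t p| ≤ (M * R + M * R ^ 2) * √h := by
  have hM₀ := hM.nonneg
  have hR₀ : 0 ≤ R := (by positivity : 0 ≤ (1 + d) * M).trans hR
  have hsqrt := Real.sqrt_le_one.2 hh.2
  by_cases hxG : x ∈ closure P.G
  · have hstep := hM.norm_nextPosition_sub_le hR π hh ht hxG e
    have hnext : P.nextPosition π h (signs e) t x ∈ cthickening R (closure P.G) :=
      mem_cthickening_of_dist_le _ x _ _ hxG <| (dist_eq_norm _ x).trans_le <|
        hstep.trans (mul_le_of_le_one_right hR₀ hsqrt)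
    refine ⟨x, hxG, ?_, ?_⟩
    · rw [mul_assoc]
      exact (hL.norm_sub_le hnext (self_subset_cthickening _ hxG)).trans (by gcongr)
    · rw [Problem.extension, taylorExtension_of_mem hxG, sub_self, abs_zero]
      positivity
  · have hz := (hπ x hxG).1
    have hz' := frontier_subset_closure hz
    refine ⟨π x, hz', ?_, ?_⟩
    · rw [Problem.nextPosition, if_neg hxG, sub_self, abs_zero]
      positivity
    · have hr := hx hxG
      have hr₀ : 0 ≤ infDist x (frontier P.G) := infDist_nonneg
      calc |P.extension π u t x - u t (π x)| ≤ M * (R * √h + (R * √h) ^ 2) :=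
            (hM.abs_extension_sub_le hπ (hν _ hz) ht hxG).trans (by gcongr)
        _ ≤ M * (R * √h + R ^ 2 * √h) := by
            rw [mul_pow, sq √h]
            gcongr
            exact mul_le_of_le_one_left (Real.sqrt_nonneg h) hsqrt
        _ = (M * R + M * R ^ 2) * √h := by ring

theorem abs_final_error_le (hM : UniformBounds P u M) (hu : P.SolvesEquations ν u)
    (hR : (1 + d) * M ≤ R) {L : ℝ≥0} (hL : LipschitzOnWith L P.φ (cthickening R (closure P.G)))
    (hπ : IsBoundaryProjection P.G π) (hν : ∀ z ∈ frontier P.G, HasInwardCones P.G z (ν z))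
    (hh : h ∈ Icc 0 1) (ht : t ∈ Icc 0 P.T) (hend : P.T < t + P.duration π h x)
    (hx : x ∉ closure P.G → infDist x (frontier P.G) ≤ R * √h) (e : Fin d → Bool) :
    |P.φ (P.nextPosition π h (signs e) t x) * P.growth π h t x + P.gain π h t x -
        P.extension π u t x| ≤
      (L * R + M * R + M * R ^ 2 +
        (M + (M + L * R + 1) * (M + M ^ 2)) * (1 + R * M)) * √h := by
  have hM₀ := hM.nonneg
  have hR₀ : 0 ≤ R := (by positivity : 0 ≤ (1 + d) * M).trans hR
  obtain ⟨p, hp, hφ, hextension⟩ := hM.exists_mem_closure_abs_sub_le hR hL hπ hν hh ht hx e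
  have hgrowth := hM.abs_growth_sub_one_le hπ hh.1 ht x
  have hgain := hM.abs_gain_le hπ hh.1 ht x
  have hduration := hM.duration_le hR₀ hπ hh hx
  have hT : P.T ∈ Icc 0 P.T := right_mem_Icc.2 (ht.1.trans ht.2)
  have htime : |P.φ p - u t p| ≤ M * P.duration π h x := by
    rw [← hu.terminal p hp]
    refine (hM.lipschitz_time.norm_sub_le t ht _ hT p hp).trans ?_
    gcongr
    rw [abs_of_nonneg (sub_nonneg.2 ht.2)]
    linarith
  have hφp : |P.φ p| ≤ M := hu.terminal p hp ▸ hM.lipschitz_time.norm_le _ hT p hp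
  set F := P.φ (P.nextPosition π h (signs e) t x)
  set V := P.extension π u t x
  set δ := P.duration π h x
  have hF : |F| ≤ M + L * R := by
    have : L * R * √h ≤ L * R := mul_le_of_le_one_right (by positivity) (Real.sqrt_le_one.2 hh.2)
    linarith [abs_sub_abs_le_abs_sub F (P.φ p)]
  have hFV : |F - V| ≤ L * R * √h + M * δ + (M * R + M * R ^ 2) * √h := by
    rw [abs_sub_comm V] at hextension
    linarith [abs_sub_le F (P.φ p) V, abs_sub_le (P.φ p) (u t p) V]
  have hFgrowth : |F * (P.growth π h t x - 1)| ≤ (M + L * R) * ((M + M ^ 2) * δ) := by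
    rw [abs_mul]
    gcongr
  calc |F * P.growth π h t x + P.gain π h t x - V|
      = |(F - V) + F * (P.growth π h t x - 1) + P.gain π h t x| := by ring_nf
    _ ≤ L * R * √h + M * δ + (M * R + M * R ^ 2) * √h + (M + L * R) * ((M + M ^ 2) * δ) +
          (M + M ^ 2) * δ := (abs_add_three _ _ _).trans (by gcongr)
    _ = (L * R + M * R + M * R ^ 2) * √h + (M + (M + L * R + 1) * (M + M ^ 2)) * δ := by ring
    _ ≤ (L * R + M * R + M * R ^ 2) * √h +
          (M + (M + L * R + 1) * (M + M ^ 2)) * ((1 + R * M) * √h) := by gcongr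
    _ = _ := by ring

theorem exists_euler_error (hM : UniformBounds P u M) (hu : P.SolvesEquations ν u)
    (hG : IsOpen P.G) (hGb : Bornology.IsBounded P.G)
    (hν : ∀ z ∈ frontier P.G, HasInwardCones P.G z (ν z)) :
    ∃ K, ∀ π, IsBoundaryProjection P.G π → ∀ h ∈ Icc 0 1, ∀ t ∈ Icc 0 P.T, t + h ∈ Icc 0 P.T →
      ∀ x ∈ closure P.G,
        |(𝔼 e, P.extension π u (t + h) (P.nextPosition π h (signs e) t x)) * (1 + h * P.c t x) +
          h * P.g t x - u t x| ≤ K * (√h * h) := by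
  have hcones : ∀ z ∈ frontier P.G, ∃ n, HasInwardCones P.G z n := fun z hz => ⟨_, hν z hz⟩
  have hS := uniqueDiffOn_closure hG hcones
  obtain ⟨δ, hδ, hjoin⟩ := exists_shortlyJoined hG hGb.isCompact_closure hcones
  obtain ⟨C, hC, hcompat⟩ := exists_taylorCompatible (F := ℝ) hS
    (closure_mono (interior_maximal subset_closure hG)) hδ hjoin hM.nonneg
  exact ⟨_, fun π hπ h hh t ht hend x hx =>
    hM.abs_euler_error_le hu hS hC (hcompat _ (hM.deriv _ hend)) hπ hh ht hend hx⟩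

theorem abs_projection_step_error_le (hM : UniformBounds P u M) (hu : P.SolvesEquations ν u)
    (hR : 0 ≤ R) (hπ : IsBoundaryProjection P.G π) (hν : HasInwardCones P.G (π x) (ν (π x)))
    (hh : h ∈ Icc 0 1) (hx : P.IsRunning R h t x) (hend : t + P.duration π h x ∈ Icc 0 P.T)
    (hxG : x ∉ closure P.G) :
    |(𝔼 e, P.extension π u (t + P.duration π h x) (P.nextPosition π h (signs e) t x)) *
        P.growth π h t x + P.gain π h t x - P.extension π u t x| ≤
      (M ^ 3 * (1 + R * (M + M ^ 2)) + M ^ 2 * (M + M ^ 2) + M) * (R * M) *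
        (√h * P.duration π h x) := by
  have hM₀ := hM.nonneg
  have hz := frontier_subset_closure (hπ x hxG).1
  have hr := hx.infDist_le hxG
  have hrR : infDist x (frontier P.G) ≤ R :=
    hr.trans (mul_le_of_le_one_right hR (Real.sqrt_le_one.2 hh.2))
  simp only [Problem.nextPosition, if_neg hxG, taylorExtension_of_mem hz, Fintype.expect_const]
  refine (hM.abs_projection_error_le hu hπ hν hrR hx.time_mem hend hxG).trans ?_
  calc _ ≤ (M ^ 3 * (1 + R * (M + M ^ 2)) + M ^ 2 * (M + M ^ 2) + M) *
        (R * √h * (M * P.duration π h x)) := by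
        rw [sq (infDist x _)]
        have := infDist_nonneg (x := x) (s := frontier P.G)
        gcongr
        exact hM.infDist_le_mul_duration hπ h hxG
    _ = _ := by ring

theorem exists_step_error (hM : UniformBounds P u M) (hu : P.SolvesEquations ν u)
    (hG : IsOpen P.G) (hGb : Bornology.IsBounded P.G)
    (hν : ∀ z ∈ frontier P.G, HasInwardCones P.G z (ν z)) (hR : 0 ≤ R) :
    ∃ K, ∀ π, IsBoundaryProjection P.G π → ∀ h ∈ Icc 0 1, ∀ t x, P.IsRunning R h t x →
      t + P.duration π h x ≤ P.T →
      |(𝔼 e, P.extension π u (t + P.duration π h x) (P.nextPosition π h (signs e) t x)) *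
        P.growth π h t x + P.gain π h t x - P.extension π u t x| ≤ K * (√h * P.duration π h x) := by
  obtain ⟨K₁, hK₁⟩ := hM.exists_euler_error hu hG hGb hν
  obtain ⟨K₂, hK₂⟩ : ∃ K₂, ∀ π, IsBoundaryProjection P.G π → ∀ h ∈ Icc 0 1, ∀ t x,
      P.IsRunning R h t x → t + P.duration π h x ∈ Icc 0 P.T → x ∉ closure P.G →
      |(𝔼 e, P.extension π u (t + P.duration π h x) (P.nextPosition π h (signs e) t x)) *
        P.growth π h t x + P.gain π h t x - P.extension π u t x| ≤ K₂ * (√h * P.duration π h x) :=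
    ⟨_, fun π hπ h hh t x hx hend hxG =>
      hM.abs_projection_step_error_le hu hR hπ (hν _ (hπ x hxG).1) hh hx hend hxG⟩
  refine ⟨max K₁ K₂, fun π hπ h hh t x hx hend => ?_⟩
  have hδ := Problem.duration_nonneg (fun _ => hM.μ_nonneg) hπ hh.1 x
  have hend' : t + P.duration π h x ∈ Icc 0 P.T := ⟨add_nonneg hx.time_mem.1 hδ, hend⟩
  have hscale := mul_nonneg (Real.sqrt_nonneg h) hδ
  by_cases hxG : x ∈ closure P.G
  · have hduration : P.duration π h x = h := if_pos hxG
    have hextension : P.extension π u t x = u t x := taylorExtension_of_mem hxG π _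
    rw [Problem.growth, Problem.gain, if_pos hxG, if_pos hxG, hextension]
    rw [hduration] at hend' hscale ⊢
    exact (hK₁ π hπ h hh t hx.time_mem hend' x hxG).trans
      (mul_le_mul_of_nonneg_right (le_max_left _ _) hscale)
  · exact (hK₂ π hπ h hh t x hx hend' hxG).trans
      (mul_le_mul_of_nonneg_right (le_max_right _ _) hscale)

theorem exists_stepEstimates (hM : UniformBounds P u M) (hu : P.SolvesEquations ν u)
    (hG : IsOpen P.G) (hGb : Bornology.IsBounded P.G)
    (hν : ∀ z ∈ frontier P.G, HasInwardCones P.G z (ν z)) (hφ : LocallyLipschitz P.φ) :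
    ∃ R K, 0 ≤ K ∧ ∀ π, IsBoundaryProjection P.G π → ∀ h ∈ Icc 0 1,
      StepEstimates P π u h R K := by
  have hM₀ := hM.nonneg
  obtain ⟨R, hR⟩ : ∃ R, R = (1 + d) * M := ⟨_, rfl⟩
  have hR₀ : 0 ≤ R := hR ▸ by positivity
  obtain ⟨L, hL⟩ := (hφ.locallyLipschitzOn (s := cthickening R (closure P.G)))
    |>.exists_lipschitzOnWith_of_compact hGb.isCompact_closure.cthickening
  obtain ⟨K₁, hK₁⟩ := hM.exists_step_error hu hG hGb hν hR₀
  obtain ⟨K₂, hK₂⟩ : ∃ K₂, ∀ π, IsBoundaryProjection P.G π → ∀ h ∈ Icc 0 1, ∀ t x,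
      P.IsRunning R h t x → P.T < t + P.duration π h x → ∀ e,
        |P.φ (P.nextPosition π h (signs e) t x) * P.growth π h t x + P.gain π h t x -
          P.extension π u t x| ≤ K₂ * √h :=
    ⟨_, fun _ hπ _ hh _ _ hx hend e =>
      hM.abs_final_error_le hu hR.ge hL hπ hν hh hx.time_mem hend hx.infDist_le e⟩
  obtain ⟨K, hK₀, hKM, hK₁', hK₂'⟩ : ∃ K, 0 ≤ K ∧ M + M ^ 2 ≤ K ∧ K₁ ≤ K ∧ K₂ ≤ K :=
    ((eventually_ge_atTop _).and <| (eventually_ge_atTop _).and <|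
      (eventually_ge_atTop _).and (eventually_ge_atTop _)).exists
  refine ⟨R, K, hK₀, fun π hπ h hh => ?_⟩
  have hδ := Problem.duration_nonneg (fun _ => hM.μ_nonneg) hπ hh.1
  exact
    { duration_nonneg := hδ
      growth_le := fun t x hx => (hM.abs_growth_le_exp hπ hh.1 hx.time_mem x).trans <|
        Real.exp_le_exp.2 (mul_le_mul_of_nonneg_right hKM (hδ x))
      isRunning_next := fun t x hx hend e =>
        ⟨⟨add_nonneg hx.time_mem.1 (hδ x), hend⟩,
          hM.infDist_nextPosition_le hR.ge hπ hh hx.time_mem⟩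
      error := fun t x hx hend => (hK₁ π hπ h hh t x hx hend).trans <|
        mul_le_mul_of_nonneg_right hK₁' (mul_nonneg (Real.sqrt_nonneg h) (hδ x))
      final_error := fun t x hx hend e => (hK₂ π hπ h hh t x hx hend e).trans <|
        mul_le_mul_of_nonneg_right hK₂' (Real.sqrt_nonneg h) }

end UniformBounds

/-! ### Termination -/

open Classical in
/-- The remaining time, increased by `h / 2` at positions outside the closed domain: every step
lowers this by at least `h / 2`, although a projection step may take arbitrarily little time. -/
def Problem.potential (P : Problem d) (h : ℝ) (s : ChainState d) : ℝ :=
  P.T - s.t + if s.X ∈ closure P.G then 0 else h / 2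

namespace Problem

variable {P : Problem d} {π : Space d → Space d} {h : ℝ}

theorem sub_le_potential (P : Problem d) (hh : 0 ≤ h) (s : ChainState d) :
    P.T - s.t ≤ P.potential h s := by
  unfold potential
  split_ifs <;> linarith

theorem potential_le (P : Problem d) (hh : 0 ≤ h) (s : ChainState d) :
    P.potential h s ≤ P.T - s.t + h / 2 := by
  unfold potential
  split_ifs <;> linarith

theorem potential_step_le (hπ : IsBoundaryProjection P.G π) (hh : 0 ≤ h) (ξ : Fin d → ℝ)
    {s : ChainState d} (hδ : 0 ≤ P.duration π h s.X) :
    P.potential h (P.step π h ξ s) ≤ P.potential h s - h / 2 := by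
  have htime : (P.step π h ξ s).t = s.t + P.duration π h s.X := rfl
  by_cases hs : s.X ∈ closure P.G
  · have hduration : P.duration π h s.X = h := if_pos hs
    linarith [P.potential_le hh (P.step π h ξ s), P.sub_le_potential hh s]
  · have hposition : (P.step π h ξ s).X = π s.X := if_neg hs
    rw [potential, potential, hposition, if_pos (frontier_subset_closure (hπ _ hs).1), if_neg hs]
    linarith

theorem potential_chain_le (hπ : IsBoundaryProjection P.G π) (hh : 0 ≤ h)
    (hδ : ∀ x, 0 ≤ P.duration π h x) (t₀ : ℝ) (x : Space d) (ξ : ℕ → Fin d → ℝ) (k : ℕ) :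
    P.potential h (P.chain π h t₀ x ξ k) ≤ P.potential h ⟨t₀, x, 1, 0⟩ - k * (h / 2) := by
  induction k with
  | zero => simp [chain]
  | succ k ih =>
    rw [chain_succ]
    have := potential_step_le hπ hh (ξ (k + 1)) (hδ (P.chain π h t₀ x ξ k).X)
    push_cast
    linarith

theorem lt_chain_t (hπ : IsBoundaryProjection P.G π) (hh : 0 ≤ h)
    (hδ : ∀ x, 0 ≤ P.duration π h x) {t₀ : ℝ} {x : Space d} {n : ℕ}
    (hn : P.potential h ⟨t₀, x, 1, 0⟩ < n * (h / 2)) (ξ : ℕ → Fin d → ℝ) :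
    P.T < (P.chain π h t₀ x ξ n).t := by
  linarith [P.sub_le_potential hh (P.chain π h t₀ x ξ n), potential_chain_le hπ hh hδ t₀ x ξ n]

end Problem

/-! ### The expected output -/

/-- The functional `f(t, X) Y + Z` of the state of the chain. -/
def ChainState.value (s : ChainState d) (f : ℝ → Space d → ℝ) : ℝ := f s.t s.X * s.Y + s.Z

open Classical in
/-- The output of the chain started at `s` and driven by `ξ 0, ξ 1, …`, if it is stopped after at
most `n` steps. -/
def Problem.pathOutput (P : Problem d) (π : Space d → Space d) (h : ℝ) :
    (n : ℕ) → (Fin n → Fin d → ℝ) → ChainState d → ℝ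
  | 0, _, s => s.value fun _ => P.φ
  | n + 1, ξ, s => if P.T < s.t then s.value fun _ => P.φ else
      P.pathOutput π h n (Fin.tail ξ) (P.step π h (ξ 0) s)

/-- The average of `Problem.pathOutput` over all sign vectors. -/
def Problem.expectedOutput (P : Problem d) (π : Space d → Space d) (h : ℝ) (n : ℕ)
    (s : ChainState d) : ℝ :=
  𝔼 e : Fin n → Fin d → Bool, P.pathOutput π h n (fun k => signs (e k)) s

namespace Problem

variable {P : Problem d} {π : Space d → Space d} {h t₀ : ℝ} {x : Space d} {s : ChainState d}

theorem pathOutput_of_lt {n : ℕ} (hs : P.T < s.t) (ξ : Fin n → Fin d → ℝ) :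
    P.pathOutput π h n ξ s = s.value fun _ => P.φ := by
  cases n with
  | zero => rfl
  | succ n => exact if_pos hs

theorem expectedOutput_of_lt (n : ℕ) (hs : P.T < s.t) :
    P.expectedOutput π h n s = s.value fun _ => P.φ := by
  simp only [expectedOutput, pathOutput_of_lt hs, Fintype.expect_const]

theorem expectedOutput_succ (n : ℕ) (hs : s.t ≤ P.T) :
    P.expectedOutput π h (n + 1) s =
      𝔼 e, P.expectedOutput π h n (P.step π h (signs e) s) := by
  simp only [expectedOutput, pathOutput, if_neg hs.not_gt]
  rw [← Finset.expect_product' Finset.univ Finset.univ fun e₀ (e : Fin n → Fin d → Bool) =>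
    P.pathOutput π h n (fun k => signs (e k)) (P.step π h (signs e₀) s), Finset.univ_product_univ]
  exact (Fintype.expect_equiv (Fin.consEquiv fun _ => Fin d → Bool) _ _ fun _ => rfl).symm

theorem steps_eq {ξ : ℕ → Fin d → ℝ} {j : ℕ} (hlt : ∀ i < j, (P.chain π h t₀ x ξ i).t ≤ P.T)
    (hj : P.T < (P.chain π h t₀ x ξ j).t) : P.steps π h t₀ x ξ = j :=
  IsLeast.csInf_eq ⟨hj, fun _ hi => not_lt.1 fun hij => (hlt _ hij).not_gt hi⟩

theorem pathOutput_chain {ξ : ℕ → Fin d → ℝ} (n j : ℕ)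
    (hlt : ∀ i < j, (P.chain π h t₀ x ξ i).t ≤ P.T)
    (hend : ∃ k ≤ j + n, P.T < (P.chain π h t₀ x ξ k).t) :
    P.pathOutput π h n (fun k => ξ (j + k + 1)) (P.chain π h t₀ x ξ j) =
      P.output π h t₀ x ξ := by
  induction n generalizing j with
  | zero =>
    obtain ⟨k, hk, hkT⟩ := hend
    obtain rfl : k = j := hk.antisymm (not_lt.1 fun hkj => (hlt k hkj).not_gt hkT)
    rw [output, steps_eq hlt hkT]
    rfl
  | succ n ih =>
    by_cases hj : P.T < (P.chain π h t₀ x ξ j).t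
    · rw [pathOutput_of_lt hj, output, steps_eq hlt hj]
      rfl
    · rw [pathOutput, if_neg hj, ← ih (j + 1), chain_succ]
      · congr 1
        ext k
        rw [Fin.tail, Fin.val_succ, add_right_comm j 1, ← add_assoc j]
      · exact fun i hi => (Nat.lt_succ_iff_lt_or_eq.1 hi).elim (hlt i) fun h => h ▸ not_lt.1 hj
      · rwa [add_assoc, add_comm 1]

theorem value_step_sub_value (f₁ f₀ : ℝ → Space d → ℝ) (ξ : Fin d → ℝ) (s : ChainState d) :
    (P.step π h ξ s).value f₁ - s.value f₀ =
      (f₁ (s.t + P.duration π h s.X) (P.nextPosition π h ξ s.t s.X) * P.growth π h s.t s.X +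
        P.gain π h s.t s.X - f₀ s.t s.X) * s.Y := by
  simp only [ChainState.value, step]
  ring

theorem expect_value_step_sub_value (f₁ f₀ : ℝ → Space d → ℝ) (s : ChainState d) :
    (𝔼 e, (P.step π h (signs e) s).value f₁) - s.value f₀ =
      ((𝔼 e, f₁ (s.t + P.duration π h s.X) (P.nextPosition π h (signs e) s.t s.X)) *
        P.growth π h s.t s.X + P.gain π h s.t s.X - f₀ s.t s.X) * s.Y := by
  rw [← Fintype.expect_const (ι := Fin d → Bool) (s.value f₀), ← Finset.expect_sub_distrib]
  simp only [value_step_sub_value, ← Finset.expect_mul, Finset.expect_sub_distrib,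
    Finset.expect_add_distrib, Fintype.expect_const]

end Problem

namespace StepEstimates

variable {P : Problem d} {π : Space d → Space d} {u : ℝ → Space d → ℝ} {h R K : ℝ}
  {s : ChainState d}

theorem abs_expect_value_sub_le (hE : StepEstimates P π u h R K) (hs : P.IsRunning R h s.t s.X)
    (hend : s.t + P.duration π h s.X ≤ P.T) :
    |(𝔼 e, (P.step π h (signs e) s).value (P.extension π u)) - s.value (P.extension π u)| ≤
      √h * |s.Y| * (K * P.duration π h s.X) := by
  rw [Problem.expect_value_step_sub_value, abs_mul]
  calc _ ≤ K * (√h * P.duration π h s.X) * |s.Y| := by gcongr; exact hE.error _ _ hs hend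
    _ = _ := by ring

theorem abs_value_final_sub_le (hE : StepEstimates P π u h R K) (hs : P.IsRunning R h s.t s.X)
    (hend : P.T < s.t + P.duration π h s.X) (e : Fin d → Bool) :
    |((P.step π h (signs e) s).value fun _ => P.φ) - s.value (P.extension π u)| ≤
      √h * |s.Y| * K := by
  rw [Problem.value_step_sub_value, abs_mul]
  calc _ ≤ K * √h * |s.Y| := by gcongr; exact hE.final_error _ _ hs hend e
    _ = _ := by ring

theorem abs_step_Y_mul_exp_le (hE : StepEstimates P π u h R K) (hs : P.IsRunning R h s.t s.X)
    (ξ : Fin d → ℝ) (T : ℝ) :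
    |(P.step π h ξ s).Y| * Real.exp (K * (T - (P.step π h ξ s).t)) ≤
      |s.Y| * Real.exp (K * (T - s.t)) := by
  simp only [Problem.step, abs_mul]
  calc _ ≤ Real.exp (K * P.duration π h s.X) * |s.Y| *
        Real.exp (K * (T - (s.t + P.duration π h s.X))) := by
        gcongr; exact hE.growth_le _ _ hs
    _ = _ := by
        rw [mul_right_comm, ← Real.exp_add, mul_comm]
        ring_nf

theorem abs_expectedOutput_sub_le (hE : StepEstimates P π u h R K) (hK : 0 ≤ K) (hh : 0 ≤ h)
    (hπ : IsBoundaryProjection P.G π) (n : ℕ) (hs : P.IsRunning R h s.t s.X)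
    (hn : P.potential h s < n * (h / 2)) :
    |P.expectedOutput π h n s - s.value (P.extension π u)| ≤
      √h * (|s.Y| * Real.exp (K * (P.T - s.t))) * (K + K * (P.T - s.t)) := by
  induction n generalizing s with
  | zero =>
    have hpotential := P.sub_le_potential hh s
    rw [Nat.cast_zero, zero_mul] at hn
    linarith [hs.time_mem.2]
  | succ n ih =>
    have hδ := hE.duration_nonneg s.X
    have hrem : 0 ≤ P.T - s.t := sub_nonneg.2 hs.time_mem.2
    have hweight : |s.Y| ≤ |s.Y| * Real.exp (K * (P.T - s.t)) :=
      le_mul_of_one_le_right (abs_nonneg _) (Real.one_le_exp (by positivity))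
    rw [Problem.expectedOutput_succ n hs.time_mem.2]
    rcases lt_or_ge P.T (s.t + P.duration π h s.X) with hend | hend
    · simp only [Problem.expectedOutput_of_lt (s := P.step π h _ s) n hend]
      rw [← Fintype.expect_const (ι := Fin d → Bool) (s.value (P.extension π u)),
        ← Finset.expect_sub_distrib]
      refine (abs_expect_le_of_abs_le fun e => hE.abs_value_final_sub_le hs hend e).trans ?_
      gcongr
      exact le_add_of_nonneg_right (by positivity)
    · have : 0 ≤ P.T - (s.t + P.duration π h s.X) := sub_nonneg.2 hend
      have hnext : |(𝔼 e, P.expectedOutput π h n (P.step π h (signs e) s)) -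
          𝔼 e, (P.step π h (signs e) s).value (P.extension π u)| ≤
            √h * (|s.Y| * Real.exp (K * (P.T - s.t))) *
              (K + K * (P.T - (s.t + P.duration π h s.X))) := by
        rw [← Finset.expect_sub_distrib]
        refine abs_expect_le_of_abs_le fun e => (ih (hE.isRunning_next _ _ hs hend e) ?_).trans ?_
        · have := Problem.potential_step_le hπ hh (signs e) hδ
          push_cast at hn
          linarith
        · have := hE.abs_step_Y_mul_exp_le hs (signs e) P.T
          exact mul_le_mul_of_nonneg_right (by gcongr) (by positivity)
      calc _ ≤ _ := abs_sub_le _ (𝔼 e, (P.step π h (signs e) s).value (P.extension π u)) _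
        _ ≤ √h * (|s.Y| * Real.exp (K * (P.T - s.t))) *
              (K + K * (P.T - (s.t + P.duration π h s.X))) +
            √h * (|s.Y| * Real.exp (K * (P.T - s.t))) * (K * P.duration π h s.X) :=
          add_le_add hnext ((hE.abs_expect_value_sub_le hs hend).trans (by gcongr))
        _ = _ := by ring

end StepEstimates

/-! ### Independent signs -/

section Signs

variable {Ω ι : Type*} {X : ι → Ω → ℝ}

open Classical in
/-- The Boolean vector coding the signs `X i ω`. -/
def signCode (X : ι → Ω → ℝ) (ω : Ω) (i : ι) : Bool := decide (X i ω = 1)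

theorem signs_signCode {ω : Ω} (hω : ∀ i, X i ω = 1 ∨ X i ω = -1) :
    signs (signCode X ω) = fun i => X i ω := by
  ext i
  rcases hω i with hi | hi <;> norm_num [signs, signCode, hi]

theorem signCode_preimage_singleton [Fintype ι] (X : ι → Ω → ℝ) (e : ι → Bool) :
    signCode X ⁻¹' {e} = ⋂ i ∈ Finset.univ, X i ⁻¹' if e i then {1} else {1}ᶜ := by
  ext ω
  simp only [mem_preimage, mem_singleton_iff, funext_iff, mem_iInter, Finset.mem_univ, true_imp_iff]
  refine forall_congr' fun i => ?_
  cases he : e i <;> simp [signCode]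

variable [MeasurableSpace Ω] {Pr : Measure Ω}

theorem measurable_signCode (hX : ∀ i, Measurable (X i)) : Measurable (signCode X) :=
  measurable_pi_lambda _ fun i => measurable_to_bool <| by
    simpa [signCode, preimage] using hX i (measurableSet_singleton 1)

variable [IsProbabilityMeasure Pr]

theorem ae_eq_one_or_eq_neg_one {X : Ω → ℝ} (hX : Measurable X)
    (hone : Pr {ω | X ω = 1} = 1 / 2) (hneg : Pr {ω | X ω = -1} = 1 / 2) :
    ∀ᵐ ω ∂Pr, X ω = 1 ∨ X ω = -1 := by
  have hone' : MeasurableSet {ω | X ω = 1} := hX (measurableSet_singleton 1)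
  have hneg' : MeasurableSet {ω | X ω = -1} := hX (measurableSet_singleton (-1))
  have hdisj : Disjoint {ω | X ω = 1} {ω | X ω = -1} :=
    disjoint_left.2 fun ω (h₁ : X ω = 1) (h₂ : X ω = -1) => by linarith
  refine (mem_ae_iff_prob_eq_one (hone'.union hneg')).2 ?_
  rw [measure_union hdisj hneg', hone, hneg, ENNReal.add_halves]

variable [Fintype ι]

theorem measureReal_signCode_preimage (hX : ∀ i, Measurable (X i)) (hind : iIndepFun X Pr)
    (hone : ∀ i, Pr {ω | X i ω = 1} = 1 / 2) (e : ι → Bool) :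
    Pr.real (signCode X ⁻¹' {e}) = (2 ^ Fintype.card ι)⁻¹ := by
  have hprob : ∀ i, Pr (X i ⁻¹' if e i then {1} else {1}ᶜ) = 1 / 2 := fun i => by
    have hone' : Pr (X i ⁻¹' {1}) = 1 / 2 := hone i
    split_ifs
    · exact hone'
    · rw [preimage_compl, prob_compl_eq_one_sub (hX i (measurableSet_singleton 1)), hone', one_div,
        ENNReal.one_sub_inv_two]
  rw [measureReal_def, signCode_preimage_singleton, hind.measure_inter_preimage_eq_mul _
    fun i _ => by split_ifs <;> measurability]
  simp only [hprob]
  simp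

theorem integral_comp_signs [DecidableEq ι] (hX : ∀ i, Measurable (X i)) (hind : iIndepFun X Pr)
    (hone : ∀ i, Pr {ω | X i ω = 1} = 1 / 2) (hneg : ∀ i, Pr {ω | X i ω = -1} = 1 / 2)
    (F : (ι → ℝ) → ℝ) :
    Integrable (fun ω => F fun i => X i ω) Pr ∧ ∫ ω, F (fun i => X i ω) ∂Pr = 𝔼 e, F (signs e) := by
  have hcode := measurable_signCode hX
  have hae : (fun ω => F (signs (signCode X ω))) =ᵐ[Pr] fun ω => F fun i => X i ω := by
    filter_upwards [ae_all_iff.2 fun i => ae_eq_one_or_eq_neg_one (hX i) (hone i) (hneg i)]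
      with ω hω
    rw [signs_signCode hω]
  have : IsProbabilityMeasure (Pr.map (signCode X)) :=
    Measure.isProbabilityMeasure_map hcode.aemeasurable
  have hF : Integrable (fun e => F (signs e)) (Pr.map (signCode X)) := .of_finite
  refine ⟨(hF.comp_measurable hcode).congr hae, ?_⟩
  rw [← integral_congr_ae hae,
    ← integral_map (f := fun e => F (signs e)) hcode.aemeasurable hF.aestronglyMeasurable,
    integral_fintype hF, Fintype.expect_eq_sum_div_card, Finset.sum_div,
    Fintype.card_fun, Fintype.card_bool]
  refine Finset.sum_congr rfl fun e _ => ?_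
  rw [map_measureReal_apply hcode (measurableSet_singleton e),
    measureReal_signCode_preimage hX hind hone, smul_eq_mul, inv_mul_eq_div,
    Nat.cast_pow, Nat.cast_ofNat]

end Signs

theorem IsRademacherSequence.integral_pathOutput {Ω : Type*} [MeasurableSpace Ω] {Pr : Measure Ω}
    [IsProbabilityMeasure Pr] {ξ : ℕ → Fin d → Ω → ℝ} (hξ : IsRademacherSequence Pr ξ)
    (P : Problem d) (π : Space d → Space d) (h : ℝ) (n : ℕ) (s : ChainState d) :
    Integrable (fun ω => P.pathOutput π h n (fun k i => ξ (k + 1) i ω) s) Pr ∧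
      ∫ ω, P.pathOutput π h n (fun k i => ξ (k + 1) i ω) s ∂Pr = P.expectedOutput π h n s := by
  have hinj : Function.Injective fun q : Fin n × Fin d => ((q.1 : ℕ) + 1, q.2) := fun q q' hq => by
    simpa [Prod.ext_iff, Fin.ext_iff] using hq
  obtain ⟨hint, heq⟩ := integral_comp_signs (Pr := Pr)
    (X := fun q : Fin n × Fin d => ξ (q.1 + 1) q.2)
    (fun q => hξ.measurable _ _) (hξ.indep.precomp hinj) (fun q => hξ.prob_one _ _)
    (fun q => hξ.prob_neg_one _ _) fun y => P.pathOutput π h n (fun k i => y (k, i)) s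
  exact ⟨hint, heq.trans (Fintype.expect_equiv (Equiv.curry _ _ _) _ _ fun _ => rfl)⟩

/-! ### The error of the scheme -/

theorem StepEstimates.abs_integral_output_sub_le {P : Problem d} {π : Space d → Space d}
    {u : ℝ → Space d → ℝ} {h R K : ℝ} (hE : StepEstimates P π u h R K) (hK : 0 ≤ K) (hh : 0 < h)
    (hπ : IsBoundaryProjection P.G π) {t₀ : ℝ} (ht₀ : t₀ ∈ Icc 0 P.T) {x : Space d}
    (hx : x ∈ closure P.G) {Ω : Type*} [MeasurableSpace Ω] {Pr : Measure Ω}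
    [IsProbabilityMeasure Pr] {ξ : ℕ → Fin d → Ω → ℝ} (hξ : IsRademacherSequence Pr ξ) :
    (∀ ω, ∃ k, P.T < (P.chain π h t₀ x (fun k i => ξ k i ω) k).t) ∧
      Integrable (fun ω => P.output π h t₀ x (fun k i => ξ k i ω)) Pr ∧
      |(∫ ω, P.output π h t₀ x (fun k i => ξ k i ω) ∂Pr) - u t₀ x| ≤
        √h * Real.exp (K * (P.T - t₀)) * (K + K * (P.T - t₀)) := by
  set s₀ : ChainState d := ⟨t₀, x, 1, 0⟩
  have hrunning : P.IsRunning R h s₀.t s₀.X := ⟨ht₀, fun hxG => absurd hx hxG⟩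
  obtain ⟨n, hn⟩ := exists_nat_gt (P.potential h s₀ / (h / 2))
  rw [div_lt_iff₀ (half_pos hh)] at hn
  have hend := Problem.lt_chain_t hπ hh.le hE.duration_nonneg hn
  have houtput : ∀ ω, P.output π h t₀ x (fun k i => ξ k i ω) =
      P.pathOutput π h n (fun k i => ξ (k + 1) i ω) s₀ := fun ω => by
    rw [← Problem.pathOutput_chain n 0 (fun _ hi => absurd hi (Nat.not_lt_zero _))
      ⟨n, (zero_add n).ge, hend _⟩]
    simp only [zero_add]
    rfl
  have hvalue : s₀.value (P.extension π u) = u t₀ x := by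
    rw [ChainState.value, Problem.extension, taylorExtension_of_mem hx, mul_one, add_zero]
  obtain ⟨hint, heq⟩ := hξ.integral_pathOutput P π h n s₀
  have herror := hE.abs_expectedOutput_sub_le hK hh.le hπ n hrunning hn
  rw [abs_one, one_mul, hvalue, ← heq] at herror
  simp only [houtput]
  exact ⟨fun ω => ⟨n, hend _⟩, hint, herror⟩

end StickyEuler

end

theorem mainTheorem2_general {d : ℕ} {P : StickyEuler.Problem d}
    {ν : StickyEuler.Space d → StickyEuler.Space d} {u : ℝ → StickyEuler.Space d → ℝ} {M : ℝ}
    (hM : StickyEuler.UniformBounds P u M) (hu : P.SolvesEquations ν u) (hG : IsOpen P.G)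
    (hGb : Bornology.IsBounded P.G)
    (hν : ∀ z ∈ frontier P.G, StickyEuler.HasInwardCones P.G z (ν z))
    (hφ : LocallyLipschitz P.φ) :
    ∃ C : ℝ, 0 < C ∧ ∀ t₀ ∈ Set.Icc 0 P.T, ∀ x ∈ closure P.G, ∀ h ∈ Set.Ioc (0 : ℝ) 1,
      ∀ π : StickyEuler.Space d → StickyEuler.Space d, StickyEuler.IsBoundaryProjection P.G π →
      ∀ (Ω : Type*) [MeasurableSpace Ω] (Pr : Measure Ω) [IsProbabilityMeasure Pr]
        (ξ : ℕ → Fin d → Ω → ℝ), StickyEuler.IsRademacherSequence Pr ξ →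
        (∀ ω, ∃ k, P.T < (P.chain π h t₀ x (fun k i => ξ k i ω) k).t) ∧
        Integrable (fun ω => P.output π h t₀ x (fun k i => ξ k i ω)) Pr ∧
        |(∫ ω, P.output π h t₀ x (fun k i => ξ k i ω) ∂Pr) - u t₀ x| ≤ C * h ^ (1 / 2 : ℝ) := by
  obtain ⟨R, K, hK, hE⟩ := hM.exists_stepEstimates hu hG hGb hν hφ
  obtain ⟨C, hC, hCK⟩ : ∃ C, 0 < C ∧ ∀ t₀ ∈ Icc 0 P.T,
      Real.exp (K * (P.T - t₀)) * (K + K * (P.T - t₀)) ≤ C :=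
    ⟨max (Real.exp (K * P.T) * (K + K * P.T)) 1, by positivity, fun t₀ ht₀ =>
      le_max_of_le_left <| by
        have hrem : 0 ≤ P.T - t₀ := sub_nonneg.2 ht₀.2
        have hle : P.T - t₀ ≤ P.T := sub_le_self _ ht₀.1
        gcongr⟩
  refine ⟨C, hC, fun t₀ ht₀ x hx h hh π hπ Ω _ Pr _ ξ hξ => ?_⟩
  obtain ⟨hend, hint, herror⟩ := (hE π hπ h (Ioc_subset_Icc_self hh)).abs_integral_output_sub_le
    hK hh.1 hπ ht₀ hx hξ
  refine ⟨hend, hint, herror.trans ?_⟩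
  rw [← Real.sqrt_eq_rpow, mul_assoc, mul_comm]
  exact mul_le_mul_of_nonneg_right (hCK t₀ ht₀) (Real.sqrt_nonneg h)

theorem mainTheorem2 {d : ℕ} (P : StickyEuler.Problem d) (ε : ℝ≥0) (hε : 0 < ε ∧ ε < 1)
    (hP : P.IsAdmissible ε)
    (ν : StickyEuler.Space d → StickyEuler.Space d)
    (hν : ∀ z ∈ frontier P.G, StickyEuler.IsInwardUnitNormal P.G z (ν z))
    (u : ℝ → StickyEuler.Space d → ℝ) (hu : P.IsSolution ε ν u)
    (t₀ : ℝ) (ht₀ : t₀ ∈ Set.Ico 0 P.T) (x : StickyEuler.Space d) (hx : x ∈ P.G) :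
    ∃ C : ℝ, 0 < C ∧ ∀ h ∈ Set.Ioo (0 : ℝ) 1,
      ∀ π : StickyEuler.Space d → StickyEuler.Space d, StickyEuler.IsBoundaryProjection P.G π →
      ∀ (Ω : Type*) [MeasurableSpace Ω] (Pr : Measure Ω) [IsProbabilityMeasure Pr]
        (ξ : ℕ → Fin d → Ω → ℝ), StickyEuler.IsRademacherSequence Pr ξ →
        (∀ ω, ∃ k, P.T < (P.chain π h t₀ x (fun k i => ξ k i ω) k).t) ∧
        Integrable (fun ω => P.output π h t₀ x (fun k i => ξ k i ω)) Pr ∧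
        |(∫ ω, P.output π h t₀ x (fun k i => ξ k i ω) ∂Pr) - u t₀ x| ≤ C * h ^ (1 / 2 : ℝ) := by
  obtain ⟨M, hM⟩ := hu.exists_uniformBounds hP
  obtain ⟨C, hC, hmain⟩ := mainTheorem2_general hM hu.solvesEquations hP.isOpen hP.isBounded
    (fun z hz => (hν z hz).hasInwardCones) hP.φ_lipschitz
  exact ⟨C, hC, fun h hh => hmain t₀ (Ico_subset_Icc_self ht₀) x (subset_closure hx) h
    (Ioo_subset_Ioc_self hh)⟩
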